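/- Let $(M,g)$ be a smooth Riemannian manifold of dimension $m$ (Hausdorff, second countable, without boundary, possibly incomplete), with Riemannian measure $\mathrm{vol}=\mathrm{vol}_g$. Let $E\to M$ be a smooth vector bundle of finite rank, real with a smooth Riemannian metric $h$ or complex with a smooth Hermitian metric $h$, and let $\nabla$ be a smooth metric connection on $E$, i.e. $X\,h(s,t)=h(\nabla_X s,t)+h(s,\nabla_X t)$ for all smooth sections $s,t$ and tangent vectors $X$. For $1\le p<\infty$ let $L^p(M,E)$ be the space of measurable sections $s$ of $E$ (modulo equality almost everywhere) with $\|s\|_{L^p}=\big(\int_M |s|_h^p\,d\mathrm{vol}\big)^{1/p}<\infty$; $L^2(M,T^*M\otimes E)$ is defined in the same way, through the metric on $T^*M\otimes E$ induced by $g$ and $h$. Let $W^{1,2}_0(M,E)$ be the space of those $s\in L^2(M,E)$ for which there are a $w\in L^2(M,T^*M\otimes E)$ and smooth compactly supported sections $s_n$ of $E$ with $s_n\to s$ in $L^2(M,E)$ and $\nabla s_n\to w$ in $L^2(M,T^*M\otimes E)$. Then $w=:\nabla_{\min}s$ is uniquely determined by $s$, and $W^{1,2}_0(M,E)$ is normed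 by $\|s\|_{L^2}+\|\nabla_{\min}s\|_{L^2}$. Let $W^{1,2}_0(M,g)$ be the space obtained in the case of the trivial bundle $M\times\mathbb R$ with its standard metric and $\nabla=d$. Suppose that for some real number $v>2$ there is a continuous inclusion $W^{1,2}_0(M,g)\hookrightarrow L^{\frac{2v}{v-2}}(M,g)$ into the $L^{\frac{2v}{v-2}}$-space of functions. Then, for every such $(E,h,\nabla)$: 1. there is a continuous inclusion $W^{1,2}_0(M,E)\hookrightarrow L^{\frac{2v}{v-2}}(M,E)$; 2. if $\mathrm{vol}(M)<\infty$, then the inclusion $W^{1,2}_0(M,E)\hookrightarrow L^2(M,E)$ is a compact operator. -/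

import Mathlib

open MeasureTheory Bundle Manifold Filter Topology
open scoped ENNReal ContDiff

set_option linter.unusedSectionVars false

noncomputable section

namespace SobolevBundle

section RiemannianVolume

variable {m : ℕ} {M : Type*} [TopologicalSpace M] [ChartedSpace (EuclideanSpace ℝ (Fin m)) M]
  [RiemannianBundle (fun x : M => TangentSpace (𝓡 m) x)]

/-- The coordinate vector field `∂/∂xᵢ` of the chart `e`, at the point with coordinates `y`. -/
def coordVector (e : OpenPartialHomeomorph M (EuclideanSpace ℝ (Fin m))) (i : Fin m)
    (y : EuclideanSpace ℝ (Fin m)) : TangentSpace (𝓡 m) (e.symm y) :=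
  mfderiv (𝓡 m) (𝓡 m) e.symm y (EuclideanSpace.single i (1 : ℝ) : EuclideanSpace ℝ (Fin m))

/-- The Gram matrix `gᵢⱼ = g(∂/∂xᵢ, ∂/∂xⱼ)` of the Riemannian metric in the chart `e`. -/
def chartGram (e : OpenPartialHomeomorph M (EuclideanSpace ℝ (Fin m)))
    (y : EuclideanSpace ℝ (Fin m)) : Matrix (Fin m) (Fin m) ℝ :=
  Matrix.gram ℝ fun i => coordVector e i y

variable [MeasurableSpace M]

/-- The measure `√(det gᵢⱼ) dx` of the chart domain of `e`, as a measure on `M`. -/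
def chartVolume (e : OpenPartialHomeomorph M (EuclideanSpace ℝ (Fin m))) : Measure M :=
  ((volume.restrict e.target).withDensity
    fun y => ENNReal.ofReal √(chartGram e y).det).map e.symm

variable (m M) in
/-- The Riemannian measure of `M`. The measures `chartVolume e` agree on overlaps of charts by the
change of variables formula, so that their supremum (in the lattice of measures) is the measure
which restricts to `chartVolume e` on the domain of each chart `e`. -/
def riemannianVolume : Measure M :=
  ⨆ e ∈ atlas (EuclideanSpace ℝ (Fin m)) M, chartVolume e

end RiemannianVolume

section HS
variable {T W : Type*} [NormedAddCommGroup T] [InnerProductSpace ℝ T] [FiniteDimensional ℝ T]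
  [NormedAddCommGroup W] [InnerProductSpace ℝ W]

/-- The Hilbert-Schmidt norm of `A : T → W`, that is, the norm of `A` as an element of `T* ⊗ W`
with the inner product induced by those of `T` and `W`. -/
def hsNorm (A : T →L[ℝ] W) : ℝ := √(∑ i, ‖A (stdOrthonormalBasis ℝ T i)‖ ^ 2)

lemma hsNorm_eq_norm_toLp (A : T →L[ℝ] W) :
    hsNorm A = ‖WithLp.toLp 2 (fun i => A (stdOrthonormalBasis ℝ T i))‖ := by
  rw [hsNorm, PiLp.norm_eq_of_L2]

lemma hsNorm_nonneg (A : T →L[ℝ] W) : 0 ≤ hsNorm A := Real.sqrt_nonneg _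

lemma hsNorm_zero : hsNorm (0 : T →L[ℝ] W) = 0 := by simp [hsNorm]

lemma hsNorm_neg (A : T →L[ℝ] W) : hsNorm (-A) = hsNorm A := by simp [hsNorm]

lemma hsNorm_add_le (A B : T →L[ℝ] W) : hsNorm (A + B) ≤ hsNorm A + hsNorm B := by
  simp only [hsNorm_eq_norm_toLp]
  exact norm_add_le (WithLp.toLp 2 (fun i => A (stdOrthonormalBasis ℝ T i)))
    (WithLp.toLp 2 (fun i => B (stdOrthonormalBasis ℝ T i)))

/-- The square of the Hilbert-Schmidt norm in an arbitrary basis, through the inverse Gram matrix. -/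
lemma hsNorm_sq_eq_gram {ι : Type*} [Fintype ι] [DecidableEq ι] (v : Module.Basis ι ℝ T)
    (A : T →L[ℝ] W) :
    hsNorm A ^ 2 = ∑ j, ∑ k, (Matrix.of fun i l => inner ℝ (v i) (v l) : Matrix ι ι ℝ)⁻¹ j k *
      inner ℝ (A (v j)) (A (v k)) := by
  set b := stdOrthonormalBasis ℝ T with hb
  set G : Matrix ι ι ℝ := Matrix.of fun i l => inner ℝ (v i) (v l) with hG
  set Q : Matrix ι (Fin (Module.finrank ℝ T)) ℝ := Matrix.of fun j i => v.repr (b i) j with hQ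
  have hbv : ∀ i, b i = ∑ j, Q j i • v j := fun i => (v.sum_repr (b i)).symm
  set P : Matrix (Fin (Module.finrank ℝ T)) ι ℝ := Matrix.of fun i j => inner ℝ (b i) (v j) with hP
  have hvb : ∀ j, v j = ∑ i, P i j • b i := fun j => (b.sum_repr' (v j)).symm
  have hQP : Q * P = 1 := by
    ext j k
    have := congrArg (fun x => v.repr x j) (hvb k)
    simp only [map_sum, map_smul, Finsupp.coe_finsetSum, Finset.sum_apply, Finsupp.smul_apply, smul_eq_mul, Module.Basis.repr_self] at this
    rw [Matrix.mul_apply, Matrix.one_apply]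
    rw [Finsupp.single_apply] at this
    simp only [hQ, Matrix.of_apply]
    rw [show (if j = k then (1:ℝ) else 0) = if k = j then 1 else 0 by simp [eq_comm], this]
    exact Finset.sum_congr rfl fun i _ => mul_comm _ _
  have hGP : G = P.transpose * P := by
    ext j k
    simp only [hG, Matrix.of_apply, Matrix.mul_apply, Matrix.transpose_apply, hP]
    rw [← b.sum_inner_mul_inner]
    exact Finset.sum_congr rfl fun i _ => by rw [real_inner_comm]
  have hPQ : P * Q = 1 := by
    ext i l
    rw [Matrix.mul_apply, Matrix.one_apply]
    have : inner ℝ (b i) (b l) = if i = l then (1:ℝ) else 0 := b.inner_eq_ite i l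
    rw [← this, hbv l, inner_sum]
    refine Finset.sum_congr rfl fun j _ => ?_
    rw [inner_smul_right, mul_comm]; rfl
  have hinv : G⁻¹ = Q * Q.transpose := by
    apply Matrix.inv_eq_right_inv
    rw [hGP, Matrix.mul_assoc, ← Matrix.mul_assoc P, hPQ, Matrix.one_mul, ← Matrix.transpose_mul,
      hQP, Matrix.transpose_one]
  rw [hinv, hsNorm, Real.sq_sqrt (Finset.sum_nonneg fun _ _ => sq_nonneg _)]
  simp only [Matrix.mul_apply, Matrix.transpose_apply, Finset.sum_mul]
  calc ∑ i, ‖A (b i)‖ ^ 2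
      = ∑ i, ∑ j, ∑ k, Q j i * Q k i * inner ℝ (A (v j)) (A (v k)) := by
        refine Finset.sum_congr rfl fun i _ => ?_
        rw [← real_inner_self_eq_norm_sq, hbv i, map_sum, sum_inner]
        refine Finset.sum_congr rfl fun j _ => ?_
        rw [inner_sum]
        refine Finset.sum_congr rfl fun k _ => ?_
        rw [map_smul, map_smul, inner_smul_left, inner_smul_right]
        simp; ring
    _ = _ := by
        rw [Finset.sum_comm]
        refine Finset.sum_congr rfl fun j _ => ?_
        rw [Finset.sum_comm]
end HS

section MeasurableSections

variable {M : Type*} [TopologicalSpace M] [MeasurableSpace M]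
  {F : Type*} [NormedAddCommGroup F]
  {V : M → Type*} [TopologicalSpace (TotalSpace F V)] [∀ x, TopologicalSpace (V x)]
  [FiberBundle F V]

/-- A section is (almost everywhere) measurable if its expression in each trivialization is. -/
def AEMeasurableSection (F : Type*) [NormedAddCommGroup F] {V : M → Type*}
    [TopologicalSpace (TotalSpace F V)] [∀ x, TopologicalSpace (V x)] [FiberBundle F V]
    (μ : Measure M) (s : ∀ x, V x) : Prop :=
  ∀ e : Trivialization F (π F V), MemTrivializationAtlas e →
    AEStronglyMeasurable (fun x => (e ⟨x, s x⟩).2) (μ.restrict e.baseSet)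

variable [SecondCountableTopology M] {μ : Measure M}

lemma aestronglyMeasurable_of_trivializations {Y : Type*} [TopologicalSpace Y]
    [TopologicalSpace.PseudoMetrizableSpace Y] (f : M → Y)
    (h : ∀ x : M, AEStronglyMeasurable f (μ.restrict (trivializationAt F V x).baseSet)) :
    AEStronglyMeasurable f μ := by
  obtain ⟨t, ht, htu⟩ := TopologicalSpace.countable_cover_nhds
    (f := fun x : M => (trivializationAt F V x).baseSet)
    (fun x => (trivializationAt F V x).open_baseSet.mem_nhds
      (FiberBundle.mem_baseSet_trivializationAt' x))
  have := ht.to_subtype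
  have h' := (aestronglyMeasurable_iUnion_iff
    (s := fun x : t => (trivializationAt F V (x : M)).baseSet) (μ := μ) (f := f)).2
    fun x => h x
  rw [← Set.biUnion_eq_iUnion t (fun x _ => (trivializationAt F V x).baseSet), htu,
    Measure.restrict_univ] at h'
  exact h'

variable [NormedSpace ℝ F] [FiniteDimensional ℝ F] [BorelSpace M]

lemma AEMeasurableSection.comp_continuousOn {Y : Type*} [TopologicalSpace Y]
    [TopologicalSpace.PseudoMetrizableSpace Y] [SecondCountableTopology Y] [Nonempty Y]
    {s : ∀ x, V x} (hs : AEMeasurableSection F μ s) (e : Trivialization F (π F V))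
    [he : MemTrivializationAtlas e] (N : TotalSpace F V → Y) (hN : ContinuousOn N e.source) :
    AEStronglyMeasurable (fun x => N ⟨x, s x⟩) (μ.restrict e.baseSet) := by
  borelize F
  borelize Y
  have : ProperSpace F := FiniteDimensional.proper_real F
  have h1 : AEMeasurable (fun x => (e ⟨x, s x⟩).2) (μ.restrict e.baseSet) :=
    (hs e he).aemeasurable
  have h2 : AEMeasurable (fun x => (x, (e ⟨x, s x⟩).2)) (μ.restrict e.baseSet) :=
    aemeasurable_id.prodMk h1
  have hc : ContinuousOn (fun p : M × F => N (e.toOpenPartialHomeomorph.symm p)) e.target :=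
    hN.comp e.toOpenPartialHomeomorph.continuousOn_symm e.toOpenPartialHomeomorph.mapsTo_symm
  classical
  let y₀ : Y := Classical.arbitrary Y
  have hm : Measurable (e.target.piecewise
      (fun p : M × F => N (e.toOpenPartialHomeomorph.symm p)) fun _ => y₀) :=
    hc.measurable_piecewise continuousOn_const e.open_target.measurableSet
  refine AEMeasurable.aestronglyMeasurable ((hm.comp_aemeasurable h2).congr ?_)
  filter_upwards [ae_restrict_mem e.open_baseSet.measurableSet] with x hx
  have hx' : (⟨x, s x⟩ : TotalSpace F V) ∈ e.source := e.mem_source.2 hx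
  have h3 : (x, (e ⟨x, s x⟩).2) = e ⟨x, s x⟩ := Prod.ext (e.coe_fst hx').symm rfl
  have h4 : e ⟨x, s x⟩ ∈ e.target := e.map_source hx'
  simp only [Function.comp]
  rw [h3, Set.piecewise_eq_of_mem _ _ _ h4]
  congr 1
  exact e.toOpenPartialHomeomorph.left_inv hx'

lemma AEMeasurableSection.comp_continuous {s : ∀ x, V x} (hs : AEMeasurableSection F μ s)
    (N : TotalSpace F V → ℝ) (hN : Continuous N) :
    AEStronglyMeasurable (fun x => N ⟨x, s x⟩) μ :=
  aestronglyMeasurable_of_trivializations (F := F) (V := V) _ fun _ =>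
    hs.comp_continuousOn _ N hN.continuousOn

lemma aemeasurableSection_of_continuous {σ : ∀ x, V x}
    (hσ : Continuous fun x => (⟨x, σ x⟩ : TotalSpace F V)) (μ : Measure M) :
    AEMeasurableSection F μ σ := by
  intro e _
  borelize F
  have hc : ContinuousOn (fun x => (e ⟨x, σ x⟩).2) e.baseSet := by
    refine continuous_snd.comp_continuousOn (e.continuousOn.comp hσ.continuousOn fun x hx => ?_)
    exact e.mem_source.2 hx
  exact hc.aestronglyMeasurable e.open_baseSet.measurableSet

end MeasurableSections

section MeasurableSectionsLinear
variable {M : Type*} [TopologicalSpace M] [MeasurableSpace M] [BorelSpace M]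
  {F : Type*} [NormedAddCommGroup F]
  {V : M → Type*} [TopologicalSpace (TotalSpace F V)] [∀ x, TopologicalSpace (V x)]
  [∀ x, AddCommGroup (V x)] [FiberBundle F V] {μ : Measure M}

lemma AEMeasurableSection.zero (𝕜 : Type*) [RCLike 𝕜] [NormedSpace 𝕜 F]
    [∀ x, Module 𝕜 (V x)] [VectorBundle 𝕜 F V] : AEMeasurableSection F μ (0 : ∀ x, V x) := by
  intro e he
  refine (aestronglyMeasurable_zero (β := F)).congr ?_
  filter_upwards [ae_restrict_mem e.open_baseSet.measurableSet] with x hx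
  exact ((e.linear 𝕜 hx).map_zero).symm

lemma AEMeasurableSection.add (𝕜 : Type*) [RCLike 𝕜] [NormedSpace 𝕜 F]
    [∀ x, Module 𝕜 (V x)] [VectorBundle 𝕜 F V]
    {s t : ∀ x, V x} (hs : AEMeasurableSection F μ s)
    (ht : AEMeasurableSection F μ t) : AEMeasurableSection F μ (s + t) := by
  intro e he
  refine ((hs e he).add (ht e he)).congr ?_
  filter_upwards [ae_restrict_mem e.open_baseSet.measurableSet] with x hx
  exact ((e.linear 𝕜 hx).map_add _ _).symm

lemma AEMeasurableSection.smul {𝕜 : Type*} [RCLike 𝕜] [NormedSpace 𝕜 F]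
    [∀ x, Module 𝕜 (V x)] [VectorBundle 𝕜 F V]
    (c : 𝕜) {s : ∀ x, V x} (hs : AEMeasurableSection F μ s) :
    AEMeasurableSection F μ (c • s) := by
  intro e he
  refine ((hs e he).const_smul c).congr ?_
  filter_upwards [ae_restrict_mem e.open_baseSet.measurableSet] with x hx
  exact ((e.linear 𝕜 hx).map_smul _ _).symm

lemma AEMeasurableSection.sub (𝕜 : Type*) [RCLike 𝕜] [NormedSpace 𝕜 F]
    [∀ x, Module 𝕜 (V x)] [VectorBundle 𝕜 F V]
    {s t : ∀ x, V x} (hs : AEMeasurableSection F μ s)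
    (ht : AEMeasurableSection F μ t) : AEMeasurableSection F μ (fun x => s x - t x) := by
  intro e he
  refine ((hs e he).sub (ht e he)).congr ?_
  filter_upwards [ae_restrict_mem e.open_baseSet.measurableSet] with x hx
  exact ((e.linear 𝕜 hx).map_sub _ _).symm
end MeasurableSectionsLinear

section Norms
variable {m : ℕ} {M : Type*} [TopologicalSpace M]
  {F : Type*} [NormedAddCommGroup F] [NormedSpace ℝ F]
  {V : M → Type*} [TopologicalSpace (TotalSpace F V)]
  [∀ x, NormedAddCommGroup (V x)] [∀ x, InnerProductSpace ℝ (V x)]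
  [FiberBundle F V] [VectorBundle ℝ F V] [IsContinuousRiemannianBundle F V]

variable (F V) in
lemma continuous_fiber_norm : Continuous fun p : TotalSpace F V => ‖p.2‖ := by
  have h : Continuous fun p : TotalSpace F V => inner ℝ p.2 p.2 :=
    Continuous.inner_bundle (F := F) (E := V) (b := fun p : TotalSpace F V => p.1)
      (v := fun p => p.2) (w := fun p => p.2) continuous_id continuous_id
  simp_rw [real_inner_self_eq_norm_sq] at h
  simpa using h.sqrt

variable {T : M → Type*} {H : Type*} [NormedAddCommGroup H] [NormedSpace ℝ H]
  [FiniteDimensional ℝ H]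
  [TopologicalSpace (TotalSpace H T)]
  [∀ x, NormedAddCommGroup (T x)] [∀ x, InnerProductSpace ℝ (T x)]
  [∀ x, FiniteDimensional ℝ (T x)]
  [FiberBundle H T] [VectorBundle ℝ H T] [IsContinuousRiemannianBundle H T]

variable (F V H T) in
lemma continuous_fiber_hsNorm :
    Continuous fun p : TotalSpace (H →L[ℝ] F) (fun x => T x →L[ℝ] V x) => hsNorm p.2 := by
  suffices h : Continuous fun p : TotalSpace (H →L[ℝ] F) (fun x => T x →L[ℝ] V x) =>
      hsNorm p.2 ^ 2 by
    simpa [Real.sqrt_sq, hsNorm_nonneg] using h.sqrt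
  rw [continuous_iff_continuousAt]
  intro p₀
  let e := trivializationAt H T p₀.1
  have hp₀ : p₀.1 ∈ e.baseSet := FiberBundle.mem_baseSet_trivializationAt' p₀.1
  let b := Module.finBasis ℝ H
  let v (j) (x : M) : T x := e.symm x (b j)
  have hproj : Continuous fun p : TotalSpace (H →L[ℝ] F) (fun x => T x →L[ℝ] V x) => p.1 :=
    FiberBundle.continuous_proj _ _
  have hv (j) : ContinuousAt (fun x => (⟨x, v j x⟩ : TotalSpace H T)) p₀.1 := by
    have h1 : ContinuousOn (fun x => (⟨x, v j x⟩ : TotalSpace H T)) e.baseSet :=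
      e.continuousOn_symm.comp (f := fun x => (x, b j)) (by fun_prop) fun x hx => ⟨hx, trivial⟩
    exact h1.continuousAt (e.open_baseSet.mem_nhds hp₀)
  have hAv (j) : ContinuousAt (fun p : TotalSpace (H →L[ℝ] F) (fun x => T x →L[ℝ] V x) =>
      (⟨p.1, p.2 (v j p.1)⟩ : TotalSpace F V)) p₀ :=
    ContinuousAt.clm_bundle_apply (F₁ := H) (E₁ := T) (F₂ := F) (E₂ := V)
      (b := fun p : TotalSpace (H →L[ℝ] F) (fun x => T x →L[ℝ] V x) => p.1)
      (ϕ := fun p => p.2) (v := fun p => v j p.1) continuousAt_id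
      ((hv j).comp hproj.continuousAt)
  have hG : ContinuousAt (fun x => (Matrix.of fun i l => inner ℝ (v i x) (v l x) :
      Matrix _ _ ℝ)) p₀.1 :=
    continuousAt_pi.2 fun i => continuousAt_pi.2 fun l =>
      ContinuousAt.inner_bundle (F := H) (E := T) (b := fun x => x) (hv i) (hv l)
  have hbasis (x : M) (hx : x ∈ e.baseSet) :
      ∃ w : Module.Basis (Fin (Module.finrank ℝ H)) ℝ (T x), ∀ j, w j = v j x :=
    ⟨b.map (e.linearEquivAt (R := ℝ) x hx).symm, fun j => by simp [v]⟩
  have hdet : (Matrix.of fun i l => inner ℝ (v i p₀.1) (v l p₀.1) : Matrix _ _ ℝ).det ≠ 0 := by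
    obtain ⟨w, hw⟩ := hbasis p₀.1 hp₀
    have := (Matrix.posDef_gram_of_linearIndependent (𝕜 := ℝ) w.linearIndependent).det_pos.ne'
    simp only [← hw]
    exact this
  have hinv : ContinuousAt (fun x => (Matrix.of fun i l => inner ℝ (v i x) (v l x) :
      Matrix _ _ ℝ)⁻¹) p₀.1 := by
    refine ContinuousAt.comp (f := fun x => (Matrix.of fun i l => inner ℝ (v i x) (v l x) :
      Matrix _ _ ℝ)) (g := fun G : Matrix _ _ ℝ => G⁻¹) ?_ hG
    refine continuousAt_matrix_inv _ ?_
    rw [show (Ring.inverse : ℝ → ℝ) = fun x => x⁻¹ from funext Ring.inverse_eq_inv]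
    exact continuousAt_inv₀ hdet
  have key : ContinuousAt (fun p : TotalSpace (H →L[ℝ] F) (fun x => T x →L[ℝ] V x) =>
      ∑ j, ∑ k, (Matrix.of fun i l => inner ℝ (v i p.1) (v l p.1) : Matrix _ _ ℝ)⁻¹ j k *
        inner ℝ (p.2 (v j p.1)) (p.2 (v k p.1))) p₀ := by
    refine tendsto_finsetSum _ fun j _ => tendsto_finsetSum _ fun k _ => ?_
    refine ContinuousAt.mul ?_ ?_
    · exact ((continuousAt_pi.1 ((continuousAt_pi.1 hinv) j)) k).comp
        (f := fun p : TotalSpace (H →L[ℝ] F) (fun x => T x →L[ℝ] V x) => p.1)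
        hproj.continuousAt
    · exact ContinuousAt.inner_bundle (F := F) (E := V) (hAv j) (hAv k)
  refine key.congr ?_
  filter_upwards [hproj.continuousAt.preimage_mem_nhds (e.open_baseSet.mem_nhds hp₀)] with p hp
  obtain ⟨w, hw⟩ := hbasis p.1 hp
  simp only [← hw]
  exact (hsNorm_sq_eq_gram w p.2).symm
end Norms

section Smooth

variable {m : ℕ} {M : Type*} [TopologicalSpace M] [ChartedSpace (EuclideanSpace ℝ (Fin m)) M]
  {F : Type*} [NormedAddCommGroup F] [NormedSpace ℝ F]
  {V : M → Type*} [TopologicalSpace (TotalSpace F V)]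
  [∀ x, NormedAddCommGroup (V x)] [∀ x, InnerProductSpace ℝ (V x)]
  [FiberBundle F V] [VectorBundle ℝ F V]

instance (x : M) : FiniteDimensional ℝ (TangentSpace (𝓡 m) x) :=
  inferInstanceAs (FiniteDimensional ℝ (EuclideanSpace ℝ (Fin m)))

lemma isContinuousRiemannianBundle_of_smooth (m : ℕ)
    [ChartedSpace (EuclideanSpace ℝ (Fin m)) M]
    [h : IsContMDiffRiemannianBundle (𝓡 m) ∞ F V] : IsContinuousRiemannianBundle F V :=
  let ⟨g, hg, h'⟩ := h.exists_contMDiff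
  ⟨g, hg.continuous, h'⟩

/-- Smooth sections: `σ ∈ C^∞(M, V)`. -/
def SmoothSection (m : ℕ) [ChartedSpace (EuclideanSpace ℝ (Fin m)) M] (F : Type*)
    [NormedAddCommGroup F] [NormedSpace ℝ F] {V : M → Type*} [TopologicalSpace (TotalSpace F V)]
    [∀ x, TopologicalSpace (V x)] [FiberBundle F V] (σ : ∀ x, V x) : Prop :=
  ContMDiff (𝓡 m) ((𝓡 m).prod 𝓘(ℝ, F)) ∞ fun x => (⟨x, σ x⟩ : TotalSpace F V)

/-- Smooth sections with compact support: `σ ∈ C_c^∞(M, V)`. -/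
def TestSection (m : ℕ) [ChartedSpace (EuclideanSpace ℝ (Fin m)) M] (F : Type*)
    [NormedAddCommGroup F] [NormedSpace ℝ F] {V : M → Type*} [TopologicalSpace (TotalSpace F V)]
    [∀ x, TopologicalSpace (V x)] [∀ x, Zero (V x)] [FiberBundle F V] (σ : ∀ x, V x) : Prop :=
  SmoothSection m F σ ∧ ∃ K : Set M, IsCompact K ∧ ∀ x ∉ K, σ x = 0

variable [IsManifold (𝓡 m) ∞ M] [ContMDiffVectorBundle ∞ F V (𝓡 m)]

lemma TestSection.zero : TestSection m F (0 : ∀ x, V x) :=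
  ⟨contMDiff_zeroSection ℝ V, ∅, isCompact_empty, fun _ _ => rfl⟩

lemma TestSection.add {σ τ : ∀ x, V x} (hσ : TestSection m F σ) (hτ : TestSection m F τ) :
    TestSection m F (σ + τ) := by
  obtain ⟨h1, K, hK, h1'⟩ := hσ
  obtain ⟨h2, L, hL, h2'⟩ := hτ
  refine ⟨h1.add_section h2, K ∪ L, hK.union hL, fun x hx => ?_⟩
  rw [Set.mem_union, not_or] at hx
  simp [h1' x hx.1, h2' x hx.2]

lemma SmoothSection.smul {𝕜 : Type*} [RCLike 𝕜] [NormedSpace 𝕜 F] [IsScalarTower ℝ 𝕜 F]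
    [∀ x, Module 𝕜 (V x)] [VectorBundle 𝕜 F V] (c : 𝕜) {σ : ∀ x, V x}
    (hσ : SmoothSection m F σ) : SmoothSection m F (c • σ) := by
  intro x
  have h := (contMDiffAt_section _).1 (hσ x)
  refine (contMDiffAt_section _).2 ?_
  have h2 : ContMDiffAt (𝓡 m) 𝓘(ℝ, F) ∞
      (fun y => c • (trivializationAt F V x ⟨y, σ y⟩).2) x :=
    ((contDiff_const_smul (𝕜 := ℝ) (F := F) c).contMDiff.contMDiffAt).comp x h
  refine h2.congr_of_eventuallyEq ?_
  filter_upwards [(trivializationAt F V x).open_baseSet.mem_nhds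
    (FiberBundle.mem_baseSet_trivializationAt' x)] with y hy
  exact ((trivializationAt F V x).linear 𝕜 hy).map_smul _ _

lemma TestSection.smul {𝕜 : Type*} [RCLike 𝕜] [NormedSpace 𝕜 F] [IsScalarTower ℝ 𝕜 F]
    [∀ x, Module 𝕜 (V x)] [VectorBundle 𝕜 F V] (c : 𝕜) {σ : ∀ x, V x}
    (hσ : TestSection m F σ) : TestSection m F (c • σ) := by
  obtain ⟨h1, K, hK, h1'⟩ := hσ
  exact ⟨h1.smul c, K, hK, fun x hx => by simp [h1' x hx]⟩

end Smooth

section Sobolev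

variable (𝕜 : Type*) [RCLike 𝕜] (m : ℕ)
  {M : Type*} [TopologicalSpace M] [SecondCountableTopology M]
  [ChartedSpace (EuclideanSpace ℝ (Fin m)) M] [IsManifold (𝓡 m) ∞ M]
  [RiemannianBundle (fun x : M => TangentSpace (𝓡 m) x)]
  [IsContMDiffRiemannianBundle (𝓡 m) ∞ (EuclideanSpace ℝ (Fin m))
    (fun x : M => TangentSpace (𝓡 m) x)]
  [MeasurableSpace M] [BorelSpace M]
  (F : Type*) [NormedAddCommGroup F] [NormedSpace ℝ F] [NormedSpace 𝕜 F] [IsScalarTower ℝ 𝕜 F]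
  [FiniteDimensional ℝ F]
  (V : M → Type*) [TopologicalSpace (TotalSpace F V)]
  [∀ x, NormedAddCommGroup (V x)] [∀ x, InnerProductSpace ℝ (V x)]
  [∀ x, InnerProductSpace 𝕜 (V x)] [∀ x, IsScalarTower ℝ 𝕜 (V x)]
  [FiberBundle F V] [VectorBundle ℝ F V] [VectorBundle 𝕜 F V]
  [ContMDiffVectorBundle ∞ F V (𝓡 m)] [IsContMDiffRiemannianBundle (𝓡 m) ∞ F V]

/-- A smooth metric connection on a vector bundle `V` over `𝕜 = ℝ` or `𝕜 = ℂ` with a smooth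
Riemannian, respectively Hermitian, metric. The fibres carry a `𝕜`-inner product and a real one
that induce the same norm, so that the real one is the real part of the `𝕜`-inner product; for
`𝕜 = ℝ` they coincide. The `𝕜`-linearity of the covariant derivative (`map_smul`) and its
compatibility with the metric are required on smooth sections. -/
structure MetricConnection where
  toCovariantDerivative : CovariantDerivative (𝓡 m) F V
  contMDiff : CovariantDerivative.ContMDiffCovariantDerivative toCovariantDerivative ∞
  map_smul : ∀ (c : 𝕜) (σ : ∀ x, V x), SmoothSection m F σ →
    ∀ (x : M) (ξ : TangentSpace (𝓡 m) x),
      toCovariantDerivative (c • σ) x ξ = c • toCovariantDerivative σ x ξ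
  metric : ∀ σ τ : ∀ x, V x, SmoothSection m F σ → SmoothSection m F τ →
    ∀ (x : M) (ξ : TangentSpace (𝓡 m) x),
      mvfderiv (𝓡 m) (fun y => inner 𝕜 (σ y) (τ y)) x ξ =
        inner 𝕜 (toCovariantDerivative σ x ξ) (τ x) +
          inner 𝕜 (σ x) (toCovariantDerivative τ x ξ)


variable {𝕜 m F V} in
lemma aestronglyMeasurable_norm {s : ∀ x, V x}
    (hs : AEMeasurableSection F (riemannianVolume m M) s) :
    AEStronglyMeasurable (fun x => ‖s x‖) (riemannianVolume m M) :=
  have := isContinuousRiemannianBundle_of_smooth (F := F) (V := V) m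
  hs.comp_continuous _ (continuous_fiber_norm F V)

variable {𝕜 m F V} in
lemma aestronglyMeasurable_hsNorm {w : ∀ x : M, TangentSpace (𝓡 m) x →L[ℝ] V x}
    (hw : AEMeasurableSection (EuclideanSpace ℝ (Fin m) →L[ℝ] F) (riemannianVolume m M) w) :
    AEStronglyMeasurable (fun x => hsNorm (w x)) (riemannianVolume m M) := by
  have := isContinuousRiemannianBundle_of_smooth (F := F) (V := V) m
  have := isContinuousRiemannianBundle_of_smooth (F := EuclideanSpace ℝ (Fin m))
    (V := fun x : M => TangentSpace (𝓡 m) x) m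
  have h := continuous_fiber_hsNorm F V
    (fun x : M => TangentSpace (𝓡 m) x) (EuclideanSpace ℝ (Fin m))
  exact hw.comp_continuous (fun p => hsNorm p.2) h

variable {𝕜 m F V} in
lemma AEMeasurableSection.hom_smul (c : 𝕜) {w : ∀ x : M, TangentSpace (𝓡 m) x →L[ℝ] V x}
    (hw : AEMeasurableSection (EuclideanSpace ℝ (Fin m) →L[ℝ] F) (riemannianVolume m M) w) :
    AEMeasurableSection (EuclideanSpace ℝ (Fin m) →L[ℝ] F) (riemannianVolume m M)
      (fun x => c • w x) := by
  intro e he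
  refine ((hw e he).const_smul c).congr ?_
  filter_upwards [ae_restrict_mem e.open_baseSet.measurableSet] with x hx
  obtain ⟨_, ⟨e₁, e₂, he₁, he₂, rfl⟩, rfl⟩ := he.1
  have hx2 : x ∈ e₂.baseSet := hx.2
  ext v
  change c • e₂.continuousLinearMapAt ℝ x (w x (e₁.symmL ℝ x v)) =
    e₂.continuousLinearMapAt ℝ x (c • w x (e₁.symmL ℝ x v))
  rw [Trivialization.continuousLinearMapAt_apply,
    e₂.coe_linearMapAt_of_mem hx2]
  exact ((e₂.linear 𝕜 hx2).map_smul _ _).symm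

/-- The measurable sections `s` of `V` with `∫ ‖s‖ ^ p < ∞`. -/
def lpSubmodule (p : ℝ≥0∞) [Fact (1 ≤ p)] : Submodule 𝕜 (∀ x, V x) where
  carrier := {s | AEMeasurableSection F (riemannianVolume m M) s ∧
    eLpNorm (fun x => ‖s x‖) p (riemannianVolume m M) < ⊤}
  zero_mem' := ⟨.zero 𝕜, by simp⟩
  add_mem' := by
    intro s t hs ht
    refine ⟨hs.1.add 𝕜 ht.1, ?_⟩
    refine lt_of_le_of_lt (eLpNorm_mono_real (g := fun x => ‖s x‖ + ‖t x‖)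
      fun x => by simpa using norm_add_le (s x) (t x)) ?_
    exact lt_of_le_of_lt (eLpNorm_add_le (aestronglyMeasurable_norm hs.1)
      (aestronglyMeasurable_norm ht.1) Fact.out) (ENNReal.add_lt_top.2 ⟨hs.2, ht.2⟩)
  smul_mem' := by
    intro c s hs
    refine ⟨hs.1.smul c, ?_⟩
    have : (fun x => ‖(c • s) x‖) = ‖c‖ • fun x => ‖s x‖ := by
      ext x; simp [norm_smul]
    rw [this, eLpNorm_const_smul]
    exact ENNReal.mul_lt_top (by simp) hs.2

/-- `L^p(M, V)`, with the (semi)norm `(∫ ‖s‖ ^ p) ^ (1 / p)`. Its elements are sections; sections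
that agree almost everywhere have distance zero. -/
def LpSection (p : ℝ≥0∞) [Fact (1 ≤ p)] : Type _ := lpSubmodule 𝕜 m F V p

namespace LpSection

variable {p : ℝ≥0∞} [Fact (1 ≤ p)]

instance : AddCommGroup (LpSection 𝕜 m F V p) :=
  inferInstanceAs (AddCommGroup (lpSubmodule 𝕜 m F V p))

instance : Module 𝕜 (LpSection 𝕜 m F V p) :=
  inferInstanceAs (Module 𝕜 (lpSubmodule 𝕜 m F V p))

variable {𝕜 m F V}

/-- The underlying section. -/
def toSection (s : LpSection 𝕜 m F V p) : ∀ x, V x := s.1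

instance : SeminormedAddCommGroup (LpSection 𝕜 m F V p) :=
  AddGroupSeminorm.toSeminormedAddCommGroup
    { toFun := fun s => (eLpNorm (fun x => ‖s.toSection x‖) p (riemannianVolume m M)).toReal
      map_zero' := by
        change (eLpNorm (fun x : M => ‖(0 : V x)‖) p (riemannianVolume m M)).toReal = 0
        simp
      add_le' := by
        intro s t
        change (eLpNorm (fun x => ‖s.1 x + t.1 x‖) p (riemannianVolume m M)).toReal ≤
          (eLpNorm (fun x => ‖s.1 x‖) p (riemannianVolume m M)).toReal +
            (eLpNorm (fun x => ‖t.1 x‖) p (riemannianVolume m M)).toReal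
        rw [← ENNReal.toReal_add s.2.2.ne t.2.2.ne]
        refine ENNReal.toReal_mono (ENNReal.add_lt_top.2 ⟨s.2.2, t.2.2⟩).ne ?_
        refine le_trans (eLpNorm_mono_real (g := fun x => ‖s.1 x‖ + ‖t.1 x‖)
          fun x => by simpa using norm_add_le (s.1 x) (t.1 x)) ?_
        exact eLpNorm_add_le (aestronglyMeasurable_norm s.2.1)
          (aestronglyMeasurable_norm t.2.1) Fact.out
      neg' := by
        intro s
        change (eLpNorm (fun x : M => ‖-(s.1 x)‖) p (riemannianVolume m M)).toReal = _
        simp only [norm_neg]; rfl }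

lemma norm_def (s : LpSection 𝕜 m F V p) :
    ‖s‖ = (eLpNorm (fun x => ‖s.toSection x‖) p (riemannianVolume m M)).toReal := rfl

instance : NormedSpace 𝕜 (LpSection 𝕜 m F V p) where
  norm_smul_le c s := by
    have : (fun x => ‖(c • s).toSection x‖) = ‖c‖ • fun x => ‖s.toSection x‖ := by
      ext x
      change ‖c • s.1 x‖ = ‖c‖ * ‖s.1 x‖
      rw [norm_smul]
    rw [norm_def, norm_def, this, eLpNorm_const_smul]
    simp [ENNReal.toReal_mul]

end LpSection


variable {𝕜 m F V}

/-- `w = ∇_min s`: the section `s ∈ L²(M, V)` is the `L²`-limit of smooth compactly supported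
sections `uₙ` such that `∇ uₙ → w` in `L²(M, T*M ⊗ V)`. -/
structure IsMinimalDerivative (D : MetricConnection 𝕜 m F V) (s : LpSection 𝕜 m F V 2)
    (w : ∀ x : M, TangentSpace (𝓡 m) x →L[ℝ] V x) : Prop where
  measurable : AEMeasurableSection (EuclideanSpace ℝ (Fin m) →L[ℝ] F) (riemannianVolume m M) w
  finite : eLpNorm (fun x => hsNorm (w x)) 2 (riemannianVolume m M) < ⊤
  exists_approx : ∃ u : ℕ → ∀ x, V x, (∀ n, TestSection m F (u n)) ∧
    Tendsto (fun n => eLpNorm (fun x => ‖u n x - s.toSection x‖) 2 (riemannianVolume m M))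
      atTop (𝓝 0) ∧
    Tendsto (fun n => eLpNorm (fun x => hsNorm (D.toCovariantDerivative (u n) x - w x)) 2
      (riemannianVolume m M)) atTop (𝓝 0)


lemma hsNorm_smul {T W : Type*} [NormedAddCommGroup T] [InnerProductSpace ℝ T]
    [FiniteDimensional ℝ T] [NormedAddCommGroup W] [InnerProductSpace ℝ W]
    [InnerProductSpace 𝕜 W] [IsScalarTower ℝ 𝕜 W] (c : 𝕜) (A : T →L[ℝ] W) :
    hsNorm (c • A) = ‖c‖ * hsNorm A := by
  simp only [hsNorm, smul_apply, norm_smul, mul_pow, ← Finset.mul_sum]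
  rw [Real.sqrt_mul (sq_nonneg _), Real.sqrt_sq (norm_nonneg _)]

lemma eLpNorm_hsNorm_add_le {w z : ∀ x : M, TangentSpace (𝓡 m) x →L[ℝ] V x}
    (hw : AEMeasurableSection (EuclideanSpace ℝ (Fin m) →L[ℝ] F) (riemannianVolume m M) w)
    (hz : AEMeasurableSection (EuclideanSpace ℝ (Fin m) →L[ℝ] F) (riemannianVolume m M) z) :
    eLpNorm (fun x => hsNorm (w x + z x)) 2 (riemannianVolume m M) ≤
      eLpNorm (fun x => hsNorm (w x)) 2 (riemannianVolume m M) +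
        eLpNorm (fun x => hsNorm (z x)) 2 (riemannianVolume m M) := by
  refine le_trans (eLpNorm_mono_real (g := fun x => hsNorm (w x) + hsNorm (z x)) fun x => ?_)
    (eLpNorm_add_le (aestronglyMeasurable_hsNorm hw) (aestronglyMeasurable_hsNorm hz) one_le_two)
  rw [Real.norm_of_nonneg (hsNorm_nonneg _)]
  exact hsNorm_add_le (w x) (z x)

lemma SmoothSection.mdifferentiableAt {σ : ∀ x, V x} (hσ : SmoothSection m F σ) (x : M) :
    MDifferentiableAt (𝓡 m) ((𝓡 m).prod 𝓘(ℝ, F)) (fun x => (⟨x, σ x⟩ : TotalSpace F V)) x :=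
  (ContMDiff.mdifferentiable hσ (by simp)) x

lemma MetricConnection.map_add (D : MetricConnection 𝕜 m F V) {σ τ : ∀ x, V x}
    (hσ : SmoothSection m F σ) (hτ : SmoothSection m F τ) (x : M) :
    D.toCovariantDerivative (σ + τ) x =
      D.toCovariantDerivative σ x + D.toCovariantDerivative τ x :=
  D.toCovariantDerivative.isCovariantDerivativeOnUniv.add (hσ.mdifferentiableAt x)
    (hτ.mdifferentiableAt x)


lemma MetricConnection.aemeasurableSection (D : MetricConnection 𝕜 m F V) {σ : ∀ x, V x} (hσ : SmoothSection m F σ) :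
    AEMeasurableSection (EuclideanSpace ℝ (Fin m) →L[ℝ] F) (riemannianVolume m M)
      (fun x => D.toCovariantDerivative σ x) := by
  have h := D.contMDiff.contMDiff.contMDiff (σ := σ) (contMDiffOn_univ.2 (by exact hσ))
  exact aemeasurableSection_of_continuous (contMDiffOn_univ.1 h).continuous _

lemma IsMinimalDerivative.zero (D : MetricConnection 𝕜 m F V) :
    IsMinimalDerivative D (0 : LpSection 𝕜 m F V 2) (fun _ => 0) where
  measurable := AEMeasurableSection.zero ℝ
  finite := by simp [hsNorm_zero]
  exists_approx := by
    refine ⟨fun _ => 0, fun _ => .zero, ?_, ?_⟩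
    · have : ∀ x : M, ‖(0 : V x) - (0 : LpSection 𝕜 m F V 2).toSection x‖ = 0 := by
        intro x
        change ‖(0 : V x) - 0‖ = 0
        simp
      simp only [Pi.zero_apply, this]
      simp
    · simp [hsNorm_zero]

lemma IsMinimalDerivative.smul {D : MetricConnection 𝕜 m F V} (c : 𝕜) {s : LpSection 𝕜 m F V 2}
    {w : ∀ x : M, TangentSpace (𝓡 m) x →L[ℝ] V x} (hs : IsMinimalDerivative D s w) :
    IsMinimalDerivative D (c • s) (fun x => c • w x) where
  measurable := hs.measurable.hom_smul c
  finite := by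
    have : (fun x => hsNorm (c • w x)) = ‖c‖ • fun x => hsNorm (w x) := by
      ext x; exact hsNorm_smul c (w x)
    rw [this, eLpNorm_const_smul]
    exact ENNReal.mul_lt_top (by simp) hs.finite
  exists_approx := by
    obtain ⟨u, hu, h1, h2⟩ := hs.exists_approx
    refine ⟨fun n => c • u n, fun n => (hu n).smul c, ?_, ?_⟩
    · have : ∀ n, (fun x => ‖(c • u n) x - (c • s).toSection x‖) =
          ‖c‖ • fun x => ‖u n x - s.toSection x‖ := by
        intro n
        ext x
        change ‖c • u n x - c • s.toSection x‖ = ‖c‖ * _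
        rw [← smul_sub, norm_smul]
      simp only [this, eLpNorm_const_smul]
      simpa using ENNReal.Tendsto.const_mul h1 (Or.inr enorm_ne_top)
    · have : ∀ n, (fun x => hsNorm (D.toCovariantDerivative (c • u n) x - c • w x)) =
          ‖c‖ • fun x => hsNorm (D.toCovariantDerivative (u n) x - w x) := by
        intro n
        ext x
        have : D.toCovariantDerivative (c • u n) x = c • D.toCovariantDerivative (u n) x :=
          ContinuousLinearMap.ext fun ξ => D.map_smul c (u n) (hu n).1 x ξ
        rw [this, ← smul_sub]
        exact hsNorm_smul c _
      simp only [this, eLpNorm_const_smul]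
      simpa using ENNReal.Tendsto.const_mul h2 (Or.inr enorm_ne_top)

lemma IsMinimalDerivative.add {D : MetricConnection 𝕜 m F V} {s t : LpSection 𝕜 m F V 2}
    {w z : ∀ x : M, TangentSpace (𝓡 m) x →L[ℝ] V x} (hs : IsMinimalDerivative D s w)
    (ht : IsMinimalDerivative D t z) : IsMinimalDerivative D (s + t) (fun x => w x + z x) where
  measurable := AEMeasurableSection.add ℝ hs.measurable ht.measurable
  finite := lt_of_le_of_lt (eLpNorm_hsNorm_add_le hs.measurable ht.measurable)
    (ENNReal.add_lt_top.2 ⟨hs.finite, ht.finite⟩)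
  exists_approx := by
    obtain ⟨u, hu, hu1, hu2⟩ := hs.exists_approx
    obtain ⟨v, hv, hv1, hv2⟩ := ht.exists_approx
    refine ⟨fun n => u n + v n, fun n => (hu n).add (hv n), ?_, ?_⟩
    · have hlim := hu1.add hv1
      rw [add_zero] at hlim
      refine tendsto_of_tendsto_of_tendsto_of_le_of_le tendsto_const_nhds hlim
        (fun _ => zero_le) fun n => ?_
      have hm1 := aestronglyMeasurable_norm (AEMeasurableSection.sub 𝕜
        (aemeasurableSection_of_continuous (hu n).1.continuous _) s.2.1)
      have hm2 := aestronglyMeasurable_norm (AEMeasurableSection.sub 𝕜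
        (aemeasurableSection_of_continuous (hv n).1.continuous _) t.2.1)
      refine le_trans (eLpNorm_mono_real
        (g := fun x => ‖u n x - s.toSection x‖ + ‖v n x - t.toSection x‖) fun x => ?_)
        (eLpNorm_add_le hm1 hm2 one_le_two)
      rw [norm_norm]
      refine le_trans (le_of_eq ?_) (norm_add_le _ _)
      change ‖u n x + v n x - (s.toSection x + t.toSection x)‖ = _
      rw [add_sub_add_comm]
    · have hlim := hu2.add hv2
      rw [add_zero] at hlim
      refine tendsto_of_tendsto_of_tendsto_of_le_of_le tendsto_const_nhds hlim
        (fun _ => zero_le) fun n => ?_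
      have hm1 := AEMeasurableSection.sub ℝ (MetricConnection.aemeasurableSection D (hu n).1) hs.measurable
      have hm2 := AEMeasurableSection.sub ℝ (MetricConnection.aemeasurableSection D (hv n).1) ht.measurable
      refine le_trans (le_of_eq ?_) (eLpNorm_hsNorm_add_le hm1 hm2)
      congr 1
      ext x
      congr 1
      rw [D.map_add (hu n).1 (hv n).1, add_sub_add_comm]

/-- The `L²`-norm of `∇_min s`. Here `∇` is closable, so that the section `∇_min s` is unique up to
null sets and the infimum runs over a single number. -/
def minimalDerivativeNorm (D : MetricConnection 𝕜 m F V) (s : LpSection 𝕜 m F V 2) : ℝ :=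
  sInf {r | ∃ w, IsMinimalDerivative D s w ∧
    r = (eLpNorm (fun x => hsNorm (w x)) 2 (riemannianVolume m M)).toReal}

lemma minimalDerivativeNorm_le {D : MetricConnection 𝕜 m F V} {s : LpSection 𝕜 m F V 2}
    {w : ∀ x : M, TangentSpace (𝓡 m) x →L[ℝ] V x} (h : IsMinimalDerivative D s w) :
    minimalDerivativeNorm D s ≤
      (eLpNorm (fun x => hsNorm (w x)) 2 (riemannianVolume m M)).toReal :=
  csInf_le ⟨0, by rintro _ ⟨w, _, rfl⟩; exact ENNReal.toReal_nonneg⟩ ⟨w, h, rfl⟩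

lemma minimalDerivativeNorm_nonneg (D : MetricConnection 𝕜 m F V) (s : LpSection 𝕜 m F V 2) :
    0 ≤ minimalDerivativeNorm D s :=
  Real.sInf_nonneg (by rintro _ ⟨w, _, rfl⟩; exact ENNReal.toReal_nonneg)

lemma minimalDerivativeNorm_smul_le {D : MetricConnection 𝕜 m F V} (c : 𝕜)
    {s : LpSection 𝕜 m F V 2} (hs : ∃ w, IsMinimalDerivative D s w) :
    minimalDerivativeNorm D (c • s) ≤ ‖c‖ * minimalDerivativeNorm D s := by
  have key : ∀ w, IsMinimalDerivative D s w → minimalDerivativeNorm D (c • s) ≤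
      ‖c‖ * (eLpNorm (fun x => hsNorm (w x)) 2 (riemannianVolume m M)).toReal := by
    intro w hw
    refine (minimalDerivativeNorm_le (hw.smul c)).trans (le_of_eq ?_)
    have : (fun x => hsNorm (c • w x)) = ‖c‖ • fun x => hsNorm (w x) := by
      ext x; exact hsNorm_smul c (w x)
    rw [this, eLpNorm_const_smul]
    simp [ENNReal.toReal_mul]
  obtain ⟨w₀, hw₀⟩ := hs
  rcases eq_or_ne c 0 with rfl | hc
  · simpa using key w₀ hw₀
  · have hc' : 0 < ‖c‖ := norm_pos_iff.2 hc
    rw [← div_le_iff₀' hc']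
    refine le_csInf ⟨_, w₀, hw₀, rfl⟩ ?_
    rintro _ ⟨w, hw, rfl⟩
    rw [div_le_iff₀' hc']
    exact key w hw

lemma minimalDerivativeNorm_add_le {D : MetricConnection 𝕜 m F V} {s t : LpSection 𝕜 m F V 2}
    (hs : ∃ w, IsMinimalDerivative D s w) (ht : ∃ w, IsMinimalDerivative D t w) :
    minimalDerivativeNorm D (s + t) ≤ minimalDerivativeNorm D s + minimalDerivativeNorm D t := by
  have key : ∀ w, IsMinimalDerivative D s w → ∀ z, IsMinimalDerivative D t z →
      minimalDerivativeNorm D (s + t) ≤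
        (eLpNorm (fun x => hsNorm (w x)) 2 (riemannianVolume m M)).toReal +
          (eLpNorm (fun x => hsNorm (z x)) 2 (riemannianVolume m M)).toReal := by
    intro w hw z hz
    refine (minimalDerivativeNorm_le (hw.add hz)).trans ?_
    rw [← ENNReal.toReal_add hw.finite.ne hz.finite.ne]
    exact ENNReal.toReal_mono (ENNReal.add_lt_top.2 ⟨hw.finite, hz.finite⟩).ne
      (eLpNorm_hsNorm_add_le hw.measurable hz.measurable)
  obtain ⟨w₀, hw₀⟩ := hs
  obtain ⟨z₀, hz₀⟩ := ht
  rw [← sub_le_iff_le_add']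
  refine le_csInf ⟨_, z₀, hz₀, rfl⟩ ?_
  rintro _ ⟨z, hz, rfl⟩
  rw [sub_le_iff_le_add', ← sub_le_iff_le_add]
  refine le_csInf ⟨_, w₀, hw₀, rfl⟩ ?_
  rintro _ ⟨w, hw, rfl⟩
  rw [sub_le_iff_le_add]
  exact key w hw z hz

/-- `W^{1,2}_0(M, V) = D(∇_min)`, as a subspace of `L²(M, V)`. -/
def w0Submodule (D : MetricConnection 𝕜 m F V) : Submodule 𝕜 (LpSection 𝕜 m F V 2) where
  carrier := {s | ∃ w, IsMinimalDerivative D s w}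
  zero_mem' := ⟨_, .zero D⟩
  add_mem' := by
    rintro s t ⟨w, hw⟩ ⟨z, hz⟩
    exact ⟨_, hw.add hz⟩
  smul_mem' := by
    rintro c s ⟨w, hw⟩
    exact ⟨_, hw.smul c⟩

/-- `W^{1,2}_0(M, V)`, to be normed by `‖s‖_{L²} + ‖∇_min s‖_{L²}` and not by the `L²`-norm. -/
def W0 (D : MetricConnection 𝕜 m F V) : Type _ := w0Submodule D

namespace W0

variable (D : MetricConnection 𝕜 m F V)

instance : AddCommGroup (W0 D) := inferInstanceAs (AddCommGroup (w0Submodule D))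

instance : Module 𝕜 (W0 D) := inferInstanceAs (Module 𝕜 (w0Submodule D))

/-- The inclusion `W^{1,2}_0(M, V) → L²(M, V)`. -/
def toL2 : W0 D →ₗ[𝕜] LpSection 𝕜 m F V 2 := (w0Submodule D).subtype

/-- The graph norm `‖s‖_{L²} + ‖∇_min s‖_{L²}`. -/
instance : SeminormedAddCommGroup (W0 D) :=
  AddGroupSeminorm.toSeminormedAddCommGroup
    { toFun := fun s => ‖toL2 D s‖ + minimalDerivativeNorm D (toL2 D s)
      map_zero' := by
        have h := minimalDerivativeNorm_smul_le (0 : 𝕜) ⟨_, IsMinimalDerivative.zero D⟩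
        rw [zero_smul, norm_zero, zero_mul] at h
        rw [map_zero, norm_zero, zero_add]
        exact le_antisymm h (minimalDerivativeNorm_nonneg D 0)
      add_le' := by
        intro s t
        rw [map_add]
        have h := minimalDerivativeNorm_add_le s.2 t.2
        have h' := norm_add_le (toL2 D s) (toL2 D t)
        change minimalDerivativeNorm D (toL2 D s + toL2 D t) ≤
          minimalDerivativeNorm D (toL2 D s) + minimalDerivativeNorm D (toL2 D t) at h
        linarith
      neg' := by
        have h (s : W0 D) : minimalDerivativeNorm D (-(toL2 D s)) ≤
            minimalDerivativeNorm D (toL2 D s) := by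
          simpa using minimalDerivativeNorm_smul_le (-1 : 𝕜) (D := D) (s := toL2 D s) s.2
        intro s
        rw [map_neg, norm_neg]
        have h' := h (-s)
        rw [map_neg, neg_neg] at h'
        rw [le_antisymm (h s) h'] }

lemma norm_def (s : W0 D) : ‖s‖ = ‖toL2 D s‖ + minimalDerivativeNorm D (toL2 D s) := rfl

instance : NormedSpace 𝕜 (W0 D) where
  norm_smul_le c s := by
    rw [norm_def, norm_def, _root_.map_smul, norm_smul, mul_add]
    exact add_le_add_right (minimalDerivativeNorm_smul_le c s.2) _

end W0

/-- There is a continuous inclusion `W^{1,2}_0(M, V) ↪ L^q(M, V)`: the elements of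
`W^{1,2}_0(M, V)` lie in `L^q(M, V)`, and the resulting linear map is continuous. -/
def SobolevEmbedding (D : MetricConnection 𝕜 m F V) (q : ℝ≥0∞) (hq : 1 ≤ q) : Prop :=
  haveI : Fact (1 ≤ q) := ⟨hq⟩
  ∃ T : W0 D →L[𝕜] LpSection 𝕜 m F V q, ∀ s, (T s).toSection = (W0.toL2 D s).toSection

/-- The exponent `2 v / (v - 2)`. -/
def sobolevExponent (v : ℝ) : ℝ≥0∞ := ENNReal.ofReal (2 * v / (v - 2))

lemma one_le_sobolevExponent {v : ℝ} (hv : 2 < v) : 1 ≤ sobolevExponent v := by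
  rw [sobolevExponent, ENNReal.one_le_ofReal, one_le_div (by linarith)]
  linarith

end Sobolev

section Trivial

variable (m : ℕ)
  (M : Type*) [TopologicalSpace M] [SecondCountableTopology M]
  [ChartedSpace (EuclideanSpace ℝ (Fin m)) M] [IsManifold (𝓡 m) ∞ M]
  [RiemannianBundle (fun x : M => TangentSpace (𝓡 m) x)]
  [IsContMDiffRiemannianBundle (𝓡 m) ∞ (EuclideanSpace ℝ (Fin m))
    (fun x : M => TangentSpace (𝓡 m) x)]
  [MeasurableSpace M] [BorelSpace M]

variable {M} in
lemma mdifferentiableAt_of_trivial {f : ∀ x : M, Bundle.Trivial M ℝ x} {x : M}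
    (hf : MDifferentiableAt (𝓡 m) ((𝓡 m).prod 𝓘(ℝ, ℝ))
      (fun x => (⟨x, f x⟩ : TotalSpace ℝ (Bundle.Trivial M ℝ))) x) :
    MDifferentiableAt (𝓡 m) 𝓘(ℝ, ℝ) (fun y => (f y : ℝ)) x :=
  ((mdifferentiableAt_section _ _).1 hf)

variable {M} in
lemma contMDiff_of_trivial {f : ∀ x : M, Bundle.Trivial M ℝ x}
    (hf : SmoothSection m ℝ f) :
    ContMDiff (𝓡 m) 𝓘(ℝ, ℝ) ∞ (fun y => (f y : ℝ)) :=
  fun x => ((contMDiffAt_section _).1 (hf x))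

/-- The exterior derivative `d`, as a metric connection on the trivial bundle `M × ℝ`. For it,
`W0` is the scalar Sobolev space `W^{1,2}_0(M, g)`. -/
def trivialConnection : MetricConnection ℝ m ℝ (Bundle.Trivial M ℝ) where
  toCovariantDerivative :=
    { toFun := fun f x => mvfderiv (𝓡 m) (fun y => (f y : ℝ)) x
      isCovariantDerivativeOnUniv :=
        { add := by
            intro f g x hf hg _
            exact mvfderiv_add (mdifferentiableAt_of_trivial m hf) (mdifferentiableAt_of_trivial m hg)
          leibniz := by
            intro f g x hf hg _
            exact mvfderiv_smul hg (mdifferentiableAt_of_trivial m hf) } }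
  contMDiff := by
    refine ⟨⟨fun {f} hf x _ => ?_⟩⟩
    have hf : ContMDiff (𝓡 m) 𝓘(ℝ, ℝ) ∞ (fun y => (f y : ℝ)) :=
      contMDiff_of_trivial m (contMDiffOn_univ.1 hf)
    rw [contMDiffWithinAt_univ]
    refine (contMDiffAt_hom_bundle _).2 ⟨contMDiffAt_id, ?_⟩
    have h := (hf x).mfderiv_const (m := ∞) (by simp)
    refine h.congr_of_eventuallyEq ?_
    filter_upwards with y
    simp only [inTangentCoordinates, ContinuousLinearMap.inCoordinates]
    ext v
    simp
    rfl
  map_smul := by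
    intro c f hf x ξ
    have h := mvfderiv_smul (I := 𝓡 m) (x := x) (a := fun _ : M => c) mdifferentiableAt_const
      (((contMDiff_of_trivial m hf) x).mdifferentiableAt (by simp))
    have h' := congrArg (fun L => L ξ) h
    rw [mvfderiv_const] at h'
    simp only [add_apply, smul_apply] at h'
    refine h'.trans ?_
    simp
  metric := by
    intro f g hf hg x ξ
    have h := mvfderiv_mul (I := 𝓡 m) (x := x) (((contMDiff_of_trivial m hg) x).mdifferentiableAt (by simp))
      (((contMDiff_of_trivial m hf) x).mdifferentiableAt (by simp))
    have h' := congrArg (fun L => L ξ) h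
    simp only [RCLike.inner_apply, conj_trivial]
    refine h'.trans ?_
    simp
    ring

end Trivial

end SobolevBundle

end

open SobolevBundle

noncomputable section

namespace SobolevBundle

/-! ### Kato's inequality -/

section Kato

variable {𝕜 : Type*} [RCLike 𝕜] {m : ℕ}
  {M : Type*} [TopologicalSpace M] [SecondCountableTopology M]
  [ChartedSpace (EuclideanSpace ℝ (Fin m)) M] [IsManifold (𝓡 m) ∞ M]
  [RiemannianBundle (fun x : M => TangentSpace (𝓡 m) x)]
  [IsContMDiffRiemannianBundle (𝓡 m) ∞ (EuclideanSpace ℝ (Fin m))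
    (fun x : M => TangentSpace (𝓡 m) x)]
  [MeasurableSpace M] [BorelSpace M]
  {F : Type*} [NormedAddCommGroup F] [NormedSpace ℝ F] [NormedSpace 𝕜 F] [IsScalarTower ℝ 𝕜 F]
  [FiniteDimensional ℝ F]
  {V : M → Type*} [TopologicalSpace (TotalSpace F V)]
  [∀ x, NormedAddCommGroup (V x)] [∀ x, InnerProductSpace ℝ (V x)]
  [∀ x, InnerProductSpace 𝕜 (V x)] [∀ x, IsScalarTower ℝ 𝕜 (V x)]
  [FiberBundle F V] [VectorBundle ℝ F V] [VectorBundle 𝕜 F V]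
  [ContMDiffVectorBundle ∞ F V (𝓡 m)] [IsContMDiffRiemannianBundle (𝓡 m) ∞ F V]

/-! The bridge from functions to sections is Kato's inequality `|d|σ|| ≤ |∇σ|`, which holds because
a metric connection gives `d|σ|² = 2 Re h(∇σ, σ)`. Since `|σ|` is not smooth at its zeros, it is
replaced by `√(|σ|² + ε²) - ε`: this is smooth, vanishes where `σ` does, is at most `|σ|`, and its
differential is bounded by `|∇σ|`. The scalar Sobolev inequality applies to it with a constant that
does not depend on `ε`, and Fatou's lemma gives the inequality for `|σ|` as `ε → 0`
(`exists_eLpNorm_testSection_le`). A second use of Fatou's lemma passes from test sections to all of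
`W^{1,2}_0` (`exists_eLpNorm_le_of_isMinimalDerivative`). This is the embedding.

Compactness splits into a local and a global half. Locally, a sequence bounded in `W^{1,2}` is
paired with a frame of compactly supported sections. In finite volume the resulting scalar functions
are bounded in `W^{1,1}`, and in a chart Rellich's theorem yields almost everywhere convergence of a
subsequence (`exists_nhds_rellich`, `MetricConnection.exists_nhds_subseq_ae_tendsto`). A countable
cover and a diagonal argument make this global. Rellich's theorem in `ℝᵐ` is proved by averaging
over the cubes of a fine grid: the averages converge along a subsequence by compactness, and a
function differs from its averages in `L¹` by at most a constant times the mesh times its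
`W^{1,1}`-norm.

Globally, the Sobolev inequality bounds the sequence in `L^q` with `q = 2v/(v-2) > 2`. On a space of
finite measure this excludes concentration, so that Vitali's theorem upgrades almost everywhere
convergence to convergence in `L²` (`tendsto_eLpNorm_of_tendsto_ae_of_eLpNorm_le`). Completeness of
`M` plays no role. -/

lemma SmoothSection.inner {σ τ : ∀ x, V x} (hσ : SmoothSection m F σ)
    (hτ : SmoothSection m F τ) :
    ContMDiff (𝓡 m) 𝓘(ℝ, ℝ) ∞ fun x => inner ℝ (σ x) (τ x) :=
  ContMDiff.inner_bundle (F := F) (E := V) hσ hτ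

lemma SmoothSection.norm_sq {σ : ∀ x, V x} (hσ : SmoothSection m F σ) :
    ContMDiff (𝓡 m) 𝓘(ℝ, ℝ) ∞ fun x => ‖σ x‖ ^ 2 := by
  simpa only [real_inner_self_eq_norm_sq] using hσ.inner hσ

lemma SmoothSection.mdifferentiableAt_norm_sq {σ : ∀ x, V x} (hσ : SmoothSection m F σ) (x : M) :
    MDifferentiableAt (𝓡 m) 𝓘(ℝ, ℝ) (fun x => ‖σ x‖ ^ 2) x :=
  hσ.norm_sq.mdifferentiable (by simp) x

/-- Polarization expresses both sides through the same norm. -/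
lemma re_inner_eq_real_inner {W : Type*} [NormedAddCommGroup W] [InnerProductSpace ℝ W]
    [InnerProductSpace 𝕜 W] (x y : W) : RCLike.re (inner 𝕜 x y) = inner ℝ x y := by
  rw [re_inner_eq_norm_add_mul_self_sub_norm_mul_self_sub_norm_mul_self_div_two,
    real_inner_eq_norm_add_mul_self_sub_norm_mul_self_sub_norm_mul_self_div_two]

/-- This is the real part of the metric rule for `σ` paired with itself. The `𝕜`-valued function
`⟨σ, σ⟩` is `‖σ‖²` followed by the linear inclusion of `ℝ`, so its derivative is real. -/
lemma MetricConnection.mvfderiv_norm_sq (D : MetricConnection 𝕜 m F V) {σ : ∀ x, V x}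
    (hσ : SmoothSection m F σ) (x : M) (ξ : TangentSpace (𝓡 m) x) :
    mvfderiv (𝓡 m) (fun y => ‖σ y‖ ^ 2) x ξ =
      2 * inner ℝ (D.toCovariantDerivative σ x ξ) (σ x) := by
  have h := D.metric σ σ hσ hσ x ξ
  have hf : (fun y => inner 𝕜 (σ y) (σ y)) =
      (RCLike.ofRealCLM : ℝ →L[ℝ] 𝕜) ∘ fun y => ‖σ y‖ ^ 2 := by
    ext y
    simp [inner_self_eq_norm_sq_to_K]
  have hcomp : mvfderiv (𝓡 m) ((RCLike.ofRealCLM : ℝ →L[ℝ] 𝕜) ∘ fun y => ‖σ y‖ ^ 2) x ξ =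
      ((mvfderiv (𝓡 m) (fun y => ‖σ y‖ ^ 2) x ξ : ℝ) : 𝕜) := by
    have := mfderiv_comp_apply (I := 𝓡 m) (I' := 𝓘(ℝ, ℝ)) (I'' := 𝓘(ℝ, 𝕜))
      (g := (RCLike.ofRealCLM : ℝ →L[ℝ] 𝕜)) (f := fun y => ‖σ y‖ ^ 2) x
      (RCLike.ofRealCLM : ℝ →L[ℝ] 𝕜).differentiableAt.mdifferentiableAt
      (hσ.mdifferentiableAt_norm_sq x) ξ
    rw [mfderiv_eq_fderiv, ContinuousLinearMap.fderiv] at this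
    exact this
  rw [hf, hcomp] at h
  have h' := congrArg RCLike.re h
  rw [_root_.map_add, re_inner_eq_real_inner, re_inner_eq_real_inner, RCLike.ofReal_re] at h'
  rw [h', real_inner_comm (σ x), two_mul]

/-- The product rule for the real inner product is the polarization of the rule for `‖σ‖²`. -/
lemma MetricConnection.mvfderiv_inner (D : MetricConnection 𝕜 m F V) {σ τ : ∀ x, V x}
    (hσ : SmoothSection m F σ) (hτ : SmoothSection m F τ) (x : M) (ξ : TangentSpace (𝓡 m) x) :
    mvfderiv (𝓡 m) (fun y => inner ℝ (σ y) (τ y)) x ξ =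
      inner ℝ (D.toCovariantDerivative σ x ξ) (τ x) +
        inner ℝ (σ x) (D.toCovariantDerivative τ x ξ) := by
  have hστ : SmoothSection m F (σ + τ) := hσ.add_section hτ
  have hf : (fun y => inner ℝ (σ y) (τ y)) =
      (fun _ : M => (2⁻¹ : ℝ)) • ((fun y => ‖(σ + τ) y‖ ^ 2) - (fun y => ‖σ y‖ ^ 2) -
        fun y => ‖τ y‖ ^ 2) := by
    ext y
    simp only [Pi.smul_apply', Pi.sub_apply, Pi.add_apply, smul_eq_mul,
      real_inner_eq_norm_add_mul_self_sub_norm_mul_self_sub_norm_mul_self_div_two]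
    ring
  have h1 := hστ.mdifferentiableAt_norm_sq x
  have h2 := hσ.mdifferentiableAt_norm_sq x
  have h3 := hτ.mdifferentiableAt_norm_sq x
  rw [hf, mvfderiv_smul mdifferentiableAt_const ((h1.sub h2).sub h3), mvfderiv_sub (h1.sub h2) h3,
    mvfderiv_sub h1 h2, mvfderiv_const]
  simp only [add_apply, smul_apply, sub_apply, ContinuousLinearMap.smulRight_apply,
    zero_apply, zero_smul, add_zero]
  rw [D.mvfderiv_norm_sq hστ, D.mvfderiv_norm_sq hσ, D.mvfderiv_norm_sq hτ, D.map_add hσ hτ]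
  simp only [Pi.add_apply, add_apply, inner_add_left, inner_add_right, smul_eq_mul]
  rw [real_inner_comm (σ x) (D.toCovariantDerivative τ x ξ)]
  ring

lemma hsNorm_le_of_forall {T W W' : Type*} [NormedAddCommGroup T] [InnerProductSpace ℝ T]
    [FiniteDimensional ℝ T] [NormedAddCommGroup W] [InnerProductSpace ℝ W]
    [NormedAddCommGroup W'] [InnerProductSpace ℝ W'] {A : T →L[ℝ] W} {B : T →L[ℝ] W'}
    (h : ∀ ξ, ‖A ξ‖ ≤ ‖B ξ‖) : hsNorm A ≤ hsNorm B :=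
  Real.sqrt_le_sqrt (Finset.sum_le_sum fun _ _ => by gcongr; exact h _)

lemma norm_apply_le_hsNorm {T W : Type*} [NormedAddCommGroup T] [InnerProductSpace ℝ T]
    [FiniteDimensional ℝ T] [NormedAddCommGroup W] [InnerProductSpace ℝ W] (A : T →L[ℝ] W)
    (ξ : T) : ‖A ξ‖ ≤ hsNorm A * ‖ξ‖ := by
  set b := stdOrthonormalBasis ℝ T
  conv_lhs => rw [← b.sum_repr ξ, _root_.map_sum]
  calc ‖∑ i, A (b.repr ξ i • b i)‖ ≤ ∑ i, ‖A (b i)‖ * ‖b.repr ξ i‖ := by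
        refine (norm_sum_le _ _).trans (Finset.sum_le_sum fun i _ => ?_)
        rw [_root_.map_smul, norm_smul, mul_comm]
    _ ≤ √(∑ i, ‖A (b i)‖ ^ 2) * √(∑ i, ‖b.repr ξ i‖ ^ 2) := Real.sum_mul_le_sqrt_mul_sqrt _ _ _
    _ = hsNorm A * ‖ξ‖ := by
        rw [← b.repr.norm_map ξ, EuclideanSpace.norm_eq]; rfl

/-- The smooth regularization `√(|σ|² + ε²) - ε` of `|σ|`. -/
def regularizedNorm (ε : ℝ) (σ : ∀ x, V x) (x : M) : ℝ := √(‖σ x‖ ^ 2 + ε ^ 2) - ε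

lemma regularizedNorm_nonneg (ε : ℝ) (σ : ∀ x, V x) (x : M) :
    0 ≤ regularizedNorm ε σ x :=
  sub_nonneg.2 (Real.le_sqrt_of_sq_le (by nlinarith [sq_nonneg ‖σ x‖]))

lemma regularizedNorm_le {ε : ℝ} (hε : 0 < ε) (σ : ∀ x, V x) (x : M) :
    regularizedNorm ε σ x ≤ ‖σ x‖ := by
  rw [regularizedNorm, sub_le_iff_le_add, Real.sqrt_le_left (by positivity)]
  nlinarith [norm_nonneg (σ x)]

lemma tendsto_regularizedNorm (σ : ∀ x, V x) (x : M) :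
    Tendsto (fun ε => regularizedNorm ε σ x) (𝓝 0) (𝓝 ‖σ x‖) := by
  have h : Continuous fun ε => regularizedNorm ε σ x := by
    unfold regularizedNorm
    fun_prop
  simpa [regularizedNorm] using h.tendsto 0

lemma contDiff_sqrt_add {ε : ℝ} (hε : 0 < ε) {t : ℝ} (ht : 0 ≤ t) :
    ContDiffAt ℝ ∞ (fun t => √(t + ε ^ 2) - ε) t :=
  ((contDiffAt_id.add contDiffAt_const).sqrt (by positivity)).sub contDiffAt_const

lemma contMDiff_regularizedNorm {ε : ℝ} (hε : 0 < ε) {σ : ∀ x, V x}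
    (hσ : SmoothSection m F σ) : ContMDiff (𝓡 m) 𝓘(ℝ, ℝ) ∞ (regularizedNorm ε σ) := fun x =>
  ContMDiffAt.comp (f := fun x => ‖σ x‖ ^ 2) (g := fun t => √(t + ε ^ 2) - ε) x
    (contDiff_sqrt_add hε (sq_nonneg ‖σ x‖)).contMDiffAt (hσ.norm_sq x)

/-- Kato's inequality for the regularized norm. -/
lemma MetricConnection.hsNorm_mvfderiv_regularizedNorm_le (D : MetricConnection 𝕜 m F V)
    {ε : ℝ} (hε : 0 < ε) {σ : ∀ x, V x} (hσ : SmoothSection m F σ) (x : M) :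
    hsNorm (mvfderiv (𝓡 m) (regularizedNorm ε σ) x) ≤ hsNorm (D.toCovariantDerivative σ x) := by
  refine hsNorm_le_of_forall fun ξ => ?_
  have hpos : 0 < ‖σ x‖ ^ 2 + ε ^ 2 := by positivity
  have hd : HasDerivAt (fun t => √(t + ε ^ 2) - ε) (1 / (2 * √(‖σ x‖ ^ 2 + ε ^ 2)))
      (‖σ x‖ ^ 2) :=
    (((hasDerivAt_id (‖σ x‖ ^ 2)).add_const (ε ^ 2)).sqrt hpos.ne').sub_const ε
  have hc : mvfderiv (𝓡 m) (regularizedNorm ε σ) x ξ =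
      (1 / (2 * √(‖σ x‖ ^ 2 + ε ^ 2))) * mvfderiv (𝓡 m) (fun y => ‖σ y‖ ^ 2) x ξ := by
    have := mvfderiv_comp_apply (I := 𝓘(ℝ, ℝ)) (I' := 𝓡 m) (f := fun y => ‖σ y‖ ^ 2)
      (g := fun t : ℝ => √(t + ε ^ 2) - ε) x
      hd.differentiableAt.mdifferentiableAt (hσ.mdifferentiableAt_norm_sq x) ξ
    refine this.trans ?_
    simp only [mvfderiv, mfderiv_eq_fderiv, hd.hasFDerivAt.fderiv]
    exact mul_comm _ _
  have hsq : 0 < √(‖σ x‖ ^ 2 + ε ^ 2) := Real.sqrt_pos.2 hpos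
  have hle : ‖σ x‖ ≤ √(‖σ x‖ ^ 2 + ε ^ 2) := Real.le_sqrt_of_sq_le (by nlinarith [sq_nonneg ε])
  -- The derivative along `ξ` is `⟨∇_ξ σ, σ⟩ / √(‖σ‖² + ε²)`. By Cauchy-Schwarz and `‖σ‖ ≤ √(‖σ‖² +
  -- ε²)` it is at most `‖∇_ξ σ‖` in absolute value.
  rw [hc, D.mvfderiv_norm_sq hσ, show ∀ a b : ℝ, 1 / (2 * b) * (2 * a) = a / b by
    intro a b; ring, norm_div, Real.norm_of_nonneg hsq.le, div_le_iff₀ hsq]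
  exact (norm_inner_le_norm _ _).trans (mul_le_mul_of_nonneg_left hle (norm_nonneg _))

end Kato

/-! ### The Sobolev embedding for sections -/

section Embedding

variable {𝕜 : Type*} [RCLike 𝕜] {m : ℕ}
  {M : Type*} [TopologicalSpace M] [SecondCountableTopology M]
  [ChartedSpace (EuclideanSpace ℝ (Fin m)) M] [IsManifold (𝓡 m) ∞ M]
  [RiemannianBundle (fun x : M => TangentSpace (𝓡 m) x)]
  [IsContMDiffRiemannianBundle (𝓡 m) ∞ (EuclideanSpace ℝ (Fin m))
    (fun x : M => TangentSpace (𝓡 m) x)]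
  [MeasurableSpace M] [BorelSpace M]
  {F : Type*} [NormedAddCommGroup F] [NormedSpace ℝ F] [NormedSpace 𝕜 F] [IsScalarTower ℝ 𝕜 F]
  [FiniteDimensional ℝ F]
  {V : M → Type*} [TopologicalSpace (TotalSpace F V)]
  [∀ x, NormedAddCommGroup (V x)] [∀ x, InnerProductSpace ℝ (V x)]
  [∀ x, InnerProductSpace 𝕜 (V x)] [∀ x, IsScalarTower ℝ 𝕜 (V x)]
  [FiberBundle F V] [VectorBundle ℝ F V] [VectorBundle 𝕜 F V]
  [ContMDiffVectorBundle ∞ F V (𝓡 m)] [IsContMDiffRiemannianBundle (𝓡 m) ∞ F V]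

lemma LpSection.eLpNorm_lt_top {p : ℝ≥0∞} [Fact (1 ≤ p)] (s : LpSection 𝕜 m F V p) :
    eLpNorm (fun x => ‖s.toSection x‖) p (riemannianVolume m M) < ⊤ := s.2.2

lemma eLpNorm_norm_le_sub_add {s t : ∀ x, V x} {p : ℝ≥0∞} (hp : 1 ≤ p)
    (hs : AEMeasurableSection F (riemannianVolume m M) s)
    (ht : AEMeasurableSection F (riemannianVolume m M) t) :
    eLpNorm (fun x => ‖s x‖) p (riemannianVolume m M) ≤
      eLpNorm (fun x => ‖s x - t x‖) p (riemannianVolume m M) +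
        eLpNorm (fun x => ‖t x‖) p (riemannianVolume m M) := by
  refine (eLpNorm_mono_real fun x => ?_).trans
    (eLpNorm_add_le (aestronglyMeasurable_norm (hs.sub ℝ ht)) (aestronglyMeasurable_norm ht) hp)
  rw [norm_norm]
  simpa using norm_add_le (s x - t x) (t x)

lemma eLpNorm_hsNorm_le_sub_add {w z : ∀ x : M, TangentSpace (𝓡 m) x →L[ℝ] V x}
    (hw : AEMeasurableSection (EuclideanSpace ℝ (Fin m) →L[ℝ] F) (riemannianVolume m M) w)
    (hz : AEMeasurableSection (EuclideanSpace ℝ (Fin m) →L[ℝ] F) (riemannianVolume m M) z) :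
    eLpNorm (fun x => hsNorm (w x)) 2 (riemannianVolume m M) ≤
      eLpNorm (fun x => hsNorm (w x - z x)) 2 (riemannianVolume m M) +
        eLpNorm (fun x => hsNorm (z x)) 2 (riemannianVolume m M) := by
  simpa using eLpNorm_hsNorm_add_le (hw.sub ℝ hz) hz

lemma SmoothSection.aemeasurableSection {σ : ∀ x, V x} (hσ : SmoothSection m F σ)
    (μ : Measure M) : AEMeasurableSection F μ σ :=
  aemeasurableSection_of_continuous hσ.continuous _

/-- The scalar Sobolev inequality on test functions. -/
lemma exists_eLpNorm_le_of_sobolevEmbedding {q : ℝ≥0∞} {hq : 1 ≤ q}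
    (h : SobolevEmbedding (trivialConnection m M) q hq) :
    ∃ C : ℝ≥0∞, C ≠ ⊤ ∧ ∀ f : M → ℝ, ContMDiff (𝓡 m) 𝓘(ℝ, ℝ) ∞ f →
      (∃ K : Set M, IsCompact K ∧ ∀ x ∉ K, f x = 0) →
      eLpNorm f 2 (riemannianVolume m M) < ⊤ →
      eLpNorm (fun x => hsNorm (mvfderiv (𝓡 m) f x)) 2 (riemannianVolume m M) < ⊤ →
      eLpNorm f q (riemannianVolume m M) ≤ C * (eLpNorm f 2 (riemannianVolume m M) +
        eLpNorm (fun x => hsNorm (mvfderiv (𝓡 m) f x)) 2 (riemannianVolume m M)) := by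
  have : Fact (1 ≤ q) := ⟨hq⟩
  obtain ⟨T, hT⟩ := h
  refine ⟨ENNReal.ofReal ‖T‖, ENNReal.ofReal_ne_top, fun f hf hK hf2 hdf2 => ?_⟩
  have hsm : SmoothSection m ℝ (V := Bundle.Trivial M ℝ) f := fun x =>
    (contMDiffAt_section _).2 (hf x)
  let s₀ : LpSection ℝ m ℝ (Bundle.Trivial M ℝ) 2 :=
    ⟨f, hsm.aemeasurableSection _, by simpa only [eLpNorm_norm] using hf2⟩
  have hmin : IsMinimalDerivative (trivialConnection m M) s₀ (fun x => mvfderiv (𝓡 m) f x) :=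
    { measurable := (trivialConnection m M).aemeasurableSection hsm
      finite := hdf2
      exists_approx := by
        -- A test function is approximated by the constant sequence.
        refine ⟨fun _ => f, fun _ => ⟨hsm, hK⟩, ?_, ?_⟩
        · have : ∀ x, f x - s₀.toSection x = 0 := fun x => sub_self (f x)
          simp [this]
        · have : ∀ x, (trivialConnection m M).toCovariantDerivative f x - mvfderiv (𝓡 m) f x = 0 :=
            fun x => sub_self (mvfderiv (𝓡 m) f x)
          simp [this, hsNorm_zero] }
  let s : W0 (trivialConnection m M) := ⟨s₀, _, hmin⟩
  have h1 : ‖T s‖ ≤ ‖T‖ * ‖s‖ := T.le_opNorm s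
  -- The graph norm contains an infimum over all minimal derivatives. Since `df` is one of them, the
  -- upper bound needs no uniqueness of `∇_min`.
  have h2 : ‖s‖ ≤ (eLpNorm f 2 (riemannianVolume m M)).toReal +
      (eLpNorm (fun x => hsNorm (mvfderiv (𝓡 m) f x)) 2 (riemannianVolume m M)).toReal := by
    rw [W0.norm_def]
    refine add_le_add (le_of_eq ?_) (minimalDerivativeNorm_le hmin)
    rw [← eLpNorm_norm]
    rfl
  have hT0 : 0 ≤ ‖T‖ := T.opNorm_nonneg
  have h3 : eLpNorm f q (riemannianVolume m M) = ENNReal.ofReal ‖T s‖ := by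
    rw [LpSection.norm_def, ENNReal.ofReal_toReal (T s).eLpNorm_lt_top.ne, hT s, ← eLpNorm_norm]
    rfl
  rw [h3, ← ENNReal.ofReal_toReal hf2.ne, ← ENNReal.ofReal_toReal hdf2.ne,
    ← ENNReal.ofReal_add ENNReal.toReal_nonneg ENNReal.toReal_nonneg,
    ← ENNReal.ofReal_mul hT0]
  exact ENNReal.ofReal_le_ofReal (h1.trans (by gcongr))

/-- The Sobolev inequality on test sections, by Kato's inequality. -/
lemma exists_eLpNorm_testSection_le {q : ℝ≥0∞} {hq : 1 ≤ q}
    (h : SobolevEmbedding (trivialConnection m M) q hq) :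
    ∃ C : ℝ≥0∞, C ≠ ⊤ ∧ ∀ (D : MetricConnection 𝕜 m F V) (u : ∀ x, V x), TestSection m F u →
      eLpNorm (fun x => ‖u x‖) 2 (riemannianVolume m M) < ⊤ →
      eLpNorm (fun x => hsNorm (D.toCovariantDerivative u x)) 2 (riemannianVolume m M) < ⊤ →
      eLpNorm (fun x => ‖u x‖) q (riemannianVolume m M) ≤
        C * (eLpNorm (fun x => ‖u x‖) 2 (riemannianVolume m M) +
          eLpNorm (fun x => hsNorm (D.toCovariantDerivative u x)) 2 (riemannianVolume m M)) := by
  obtain ⟨C, hC, H⟩ := exists_eLpNorm_le_of_sobolevEmbedding h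
  refine ⟨C, hC, fun D u hu hu2 hDu2 => ?_⟩
  let f (n : ℕ) : M → ℝ := regularizedNorm (1 / ((n : ℝ) + 1)) u
  have hpos (n : ℕ) : 0 < 1 / ((n : ℝ) + 1) := Nat.one_div_pos_of_nat
  have hfsm (n) : ContMDiff (𝓡 m) 𝓘(ℝ, ℝ) ∞ (f n) := contMDiff_regularizedNorm (hpos n) hu.1
  have hle (n) : eLpNorm (f n) 2 (riemannianVolume m M) ≤
      eLpNorm (fun x => ‖u x‖) 2 (riemannianVolume m M) := by
    refine eLpNorm_mono fun x => ?_
    rw [norm_norm, Real.norm_of_nonneg (regularizedNorm_nonneg _ _ _)]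
    exact regularizedNorm_le (hpos n) u x
  have hdle (n) : eLpNorm (fun x => hsNorm (mvfderiv (𝓡 m) (f n) x)) 2 (riemannianVolume m M) ≤
      eLpNorm (fun x => hsNorm (D.toCovariantDerivative u x)) 2 (riemannianVolume m M) := by
    refine eLpNorm_mono fun x => ?_
    rw [Real.norm_of_nonneg (hsNorm_nonneg _), Real.norm_of_nonneg (hsNorm_nonneg _)]
    exact D.hsNorm_mvfderiv_regularizedNorm_le (hpos n) hu.1 x
  have hlim : ∀ᵐ x ∂(riemannianVolume m M), Tendsto (fun n => f n x) atTop (𝓝 ‖u x‖) :=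
    Eventually.of_forall fun x => (tendsto_regularizedNorm u x).comp
      (tendsto_one_div_add_atTop_nhds_zero_nat (𝕜 := ℝ))
  -- Fatou's lemma: the right-hand side obtained for each regularization is bounded independently of
  -- `n`.
  refine (Lp.eLpNorm_lim_le_liminf_eLpNorm
    (fun n => (hfsm n).continuous.aestronglyMeasurable) _ hlim).trans ?_
  refine (liminf_le_liminf (v := fun _ => C *
    (eLpNorm (fun x => ‖u x‖) 2 (riemannianVolume m M) +
      eLpNorm (fun x => hsNorm (D.toCovariantDerivative u x)) 2 (riemannianVolume m M)))
    (Eventually.of_forall fun n => ?_)).trans (by rw [liminf_const])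
  obtain ⟨K, hK, huK⟩ := hu.2
  refine (H (f n) (hfsm n) ⟨K, hK, fun x hx => ?_⟩ ((hle n).trans_lt hu2)
    ((hdle n).trans_lt hDu2)).trans ?_
  -- Subtracting `ε` in the regularization makes it vanish off `K`, so that it is an admissible test
  -- function.
  · simp only [f, regularizedNorm, huK x hx, norm_zero, ne_eq, OfNat.ofNat_ne_zero,
      not_false_eq_true, zero_pow, zero_add, Real.sqrt_sq (hpos n).le, sub_self]
  · exact mul_le_mul_right (add_le_add (hle n) (hdle n)) C

/-- The inequality on test sections survives graph limits: along a subsequence that converges almost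
everywhere, the left side is lower semicontinuous by Fatou's lemma, and the right side is bounded by
quantities that converge by the triangle inequality. -/
lemma exists_eLpNorm_le_of_isMinimalDerivative {q : ℝ≥0∞} {hq : 1 ≤ q}
    (h : SobolevEmbedding (trivialConnection m M) q hq) :
    ∃ C : ℝ≥0∞, C ≠ ⊤ ∧ ∀ (D : MetricConnection 𝕜 m F V) (s : LpSection 𝕜 m F V 2)
      (w : ∀ x : M, TangentSpace (𝓡 m) x →L[ℝ] V x), IsMinimalDerivative D s w →
      eLpNorm (fun x => ‖s.toSection x‖) q (riemannianVolume m M) ≤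
        C * (eLpNorm (fun x => ‖s.toSection x‖) 2 (riemannianVolume m M) +
          eLpNorm (fun x => hsNorm (w x)) 2 (riemannianVolume m M)) := by
  obtain ⟨C, hC, H⟩ := exists_eLpNorm_testSection_le (𝕜 := 𝕜) (F := F) (V := V) h
  refine ⟨C, hC, fun D s w hw => ?_⟩
  obtain ⟨u, hu, hus, huw⟩ := hw.exists_approx
  have hum (n) := (hu n).1.aemeasurableSection (riemannianVolume m M)
  -- Convergence in `L²` implies convergence in measure, and hence almost everywhere along a
  -- subsequence.
  obtain ⟨φ, hφ, hae⟩ := (tendstoInMeasure_of_tendsto_eLpNorm (g := fun _ => (0 : ℝ))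
    (f := fun n x => ‖u n x - s.toSection x‖) two_ne_zero
    (fun n => aestronglyMeasurable_norm ((hum n).sub ℝ s.2.1))
    aestronglyMeasurable_const (by simpa [Pi.sub_def] using hus)).exists_seq_tendsto_ae
  have hlim : ∀ᵐ x ∂(riemannianVolume m M),
      Tendsto (fun n => ‖u (φ n) x‖) atTop (𝓝 ‖s.toSection x‖) := by
    filter_upwards [hae] with x hx
    exact (tendsto_iff_norm_sub_tendsto_zero.2 hx).norm
  refine (Lp.eLpNorm_lim_le_liminf_eLpNorm
    (fun n => aestronglyMeasurable_norm (hum (φ n))) _ hlim).trans ?_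
  have hb : Tendsto (fun n => C *
      ((eLpNorm (fun x => ‖u (φ n) x - s.toSection x‖) 2 (riemannianVolume m M) +
        eLpNorm (fun x => ‖s.toSection x‖) 2 (riemannianVolume m M)) +
      (eLpNorm (fun x => hsNorm (D.toCovariantDerivative (u (φ n)) x - w x)) 2
        (riemannianVolume m M) + eLpNorm (fun x => hsNorm (w x)) 2 (riemannianVolume m M))))
      atTop (𝓝 (C * (eLpNorm (fun x => ‖s.toSection x‖) 2 (riemannianVolume m M) +
          eLpNorm (fun x => hsNorm (w x)) 2 (riemannianVolume m M)))) := by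
    refine ENNReal.Tendsto.const_mul ?_ (Or.inr hC)
    simpa using ((hus.comp hφ.tendsto_atTop).add_const _).add
      ((huw.comp hφ.tendsto_atTop).add_const _)
  rw [← hb.liminf_eq]
  refine liminf_le_liminf ?_
  -- Far enough in the sequence the errors are finite, which supplies the finiteness assumptions of
  -- the inequality for test sections.
  filter_upwards [hφ.tendsto_atTop.eventually (hus.eventually_lt_const ENNReal.zero_lt_top),
    hφ.tendsto_atTop.eventually (huw.eventually_lt_const ENNReal.zero_lt_top)] with n h1 h2
  have h3 := eLpNorm_norm_le_sub_add one_le_two (hum (φ n)) s.2.1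
  have h4 := eLpNorm_hsNorm_le_sub_add (D.aemeasurableSection (hu (φ n)).1) hw.measurable
  refine (H D (u (φ n)) (hu _) (h3.trans_lt (ENNReal.add_lt_top.2 ⟨h1, s.eLpNorm_lt_top⟩))
    (h4.trans_lt (ENNReal.add_lt_top.2 ⟨h2, hw.finite⟩))).trans ?_
  exact mul_le_mul_right (add_le_add h3 h4) C

/-- The scalar Sobolev embedding implies the Sobolev embedding for sections. -/
theorem sobolevEmbedding_of_trivialConnection {q : ℝ≥0∞} {hq : 1 ≤ q}
    (h : SobolevEmbedding (trivialConnection m M) q hq) (D : MetricConnection 𝕜 m F V) :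
    SobolevEmbedding D q hq := by
  have : Fact (1 ≤ q) := ⟨hq⟩
  obtain ⟨C, hC, H⟩ := exists_eLpNorm_le_of_isMinimalDerivative (𝕜 := 𝕜) (F := F) (V := V) h
  have hfin (s : W0 D) : eLpNorm (fun x => ‖(W0.toL2 D s).toSection x‖) q
      (riemannianVolume m M) < ⊤ := by
    obtain ⟨w, hw⟩ := s.2
    exact (H D _ w hw).trans_lt (ENNReal.mul_lt_top hC.lt_top
      (ENNReal.add_lt_top.2 ⟨(W0.toL2 D s).eLpNorm_lt_top, hw.finite⟩))
  let T₀ : W0 D →ₗ[𝕜] LpSection 𝕜 m F V q :=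
    { toFun := fun s => ⟨(W0.toL2 D s).toSection, (W0.toL2 D s).2.1, hfin s⟩
      map_add' := fun _ _ => rfl
      map_smul' := fun _ _ => rfl }
  refine ⟨T₀.mkContinuous C.toReal fun s => ?_, fun s => rfl⟩
  have hnorm : ‖T₀ s‖ = (eLpNorm (fun x => ‖(W0.toL2 D s).toSection x‖) q
      (riemannianVolume m M)).toReal := rfl
  have key : ∀ w, IsMinimalDerivative D (W0.toL2 D s) w → ‖T₀ s‖ ≤
      C.toReal * (‖W0.toL2 D s‖ +
        (eLpNorm (fun x => hsNorm (w x)) 2 (riemannianVolume m M)).toReal) := by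
    intro w hw
    rw [hnorm, LpSection.norm_def, ← ENNReal.toReal_add (W0.toL2 D s).eLpNorm_lt_top.ne hw.finite.ne,
      ← ENNReal.toReal_mul]
    exact ENNReal.toReal_mono (ENNReal.mul_lt_top hC.lt_top
      (ENNReal.add_lt_top.2 ⟨(W0.toL2 D s).eLpNorm_lt_top, hw.finite⟩)).ne (H D _ w hw)
  obtain ⟨w₀, hw₀⟩ := s.2
  rw [W0.norm_def]
  -- The estimate `key` holds for every minimal derivative `w`. Passing to the infimum over `w`
  -- requires dividing by the constant, so a vanishing constant is treated apart.
  rcases eq_or_lt_of_le (ENNReal.toReal_nonneg (a := C)) with h0 | h0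
  · rw [← h0, zero_mul]
    simpa [← h0] using key w₀ hw₀
  · rw [← div_le_iff₀' h0, ← sub_le_iff_le_add']
    refine le_csInf ⟨_, w₀, hw₀, rfl⟩ ?_
    rintro _ ⟨w, hw, rfl⟩
    rw [sub_le_iff_le_add', div_le_iff₀' h0]
    exact key w hw

end Embedding

/-! ### Rellich's theorem in `ℝᵐ` -/

section Rellich

/-- The fundamental theorem of calculus along the segment from `x` to `x + h` bounds the difference
by an integral of `fderiv`. Tonelli's theorem and translation invariance then make the inner
integral independent of `t`. -/
lemma lintegral_enorm_sub_translate_le {E : Type*} [NormedAddCommGroup E] [NormedSpace ℝ E]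
    [FiniteDimensional ℝ E] [MeasurableSpace E] [BorelSpace E] (μ : Measure E)
    [μ.IsAddHaarMeasure] {f : E → ℝ} (hf : ContDiff ℝ 1 f) (h : E) :
    ∫⁻ x, ‖f (x + h) - f x‖ₑ ∂μ ≤ ‖h‖ₑ * ∫⁻ x, ‖fderiv ℝ f x‖ₑ ∂μ := by
  have hdc : Continuous (fderiv ℝ f) := hf.continuous_fderiv one_ne_zero
  have hpt (x : E) : ‖f (x + h) - f x‖ₑ ≤
      ∫⁻ t in Set.Ioc (0 : ℝ) 1, ‖fderiv ℝ f (x + t • h)‖ₑ * ‖h‖ₑ := by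
    have hder (t : ℝ) : HasDerivAt (fun t : ℝ => f (x + t • h)) (fderiv ℝ f (x + t • h) h) t := by
      have h1 : HasDerivAt (fun t : ℝ => x + t • h) h t := by
        simpa using ((hasDerivAt_id t).smul_const h).const_add x
      exact ((hf.differentiable one_ne_zero).differentiableAt.hasFDerivAt).comp_hasDerivAt t h1
    have hcont : Continuous fun t : ℝ => fderiv ℝ f (x + t • h) h := by fun_prop
    have hint := intervalIntegral.integral_eq_sub_of_hasDerivAt (a := 0) (b := 1)
      (fun t _ => hder t) (hcont.intervalIntegrable _ _)
    simp only [one_smul, zero_smul, add_zero] at hint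
    rw [← hint, intervalIntegral.integral_of_le zero_le_one]
    refine (enorm_integral_le_lintegral_enorm _).trans (lintegral_mono fun t => ?_)
    exact ContinuousLinearMap.le_opENorm _ _
  calc ∫⁻ x, ‖f (x + h) - f x‖ₑ ∂μ
      ≤ ∫⁻ x, (∫⁻ t in Set.Ioc (0 : ℝ) 1, ‖fderiv ℝ f (x + t • h)‖ₑ * ‖h‖ₑ) ∂μ :=
        lintegral_mono hpt
    _ = ∫⁻ t in Set.Ioc (0 : ℝ) 1, ∫⁻ x, ‖fderiv ℝ f (x + t • h)‖ₑ * ‖h‖ₑ ∂μ := by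
        refine lintegral_lintegral_swap (Measurable.aemeasurable ?_)
        have hc : Continuous fun p : E × ℝ => ‖fderiv ℝ f (p.1 + p.2 • h)‖ₑ := by fun_prop
        exact hc.measurable.mul_const _
    _ = ∫⁻ _ in Set.Ioc (0 : ℝ) 1, ‖h‖ₑ * ∫⁻ x, ‖fderiv ℝ f x‖ₑ ∂μ := by
        refine lintegral_congr fun t => ?_
        rw [lintegral_mul_const' _ _ enorm_ne_top,
          lintegral_add_right_eq_self (fun x => ‖fderiv ℝ f x‖ₑ) (t • h), mul_comm]
    _ = ‖h‖ₑ * ∫⁻ x, ‖fderiv ℝ f x‖ₑ ∂μ := by simp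

variable {m : ℕ}

/-- The index of the cube of the grid of mesh `1 / N` that contains `x`. -/
def gridIndex (N : ℕ) (x : Fin m → ℝ) : Fin m → ℤ := fun i => ⌊N * x i⌋

/-- The cubes of the grid of mesh `1 / N`. -/
def gridCube (N : ℕ) (z : Fin m → ℤ) : Set (Fin m → ℝ) := gridIndex N ⁻¹' {z}

lemma measurable_gridIndex (N : ℕ) : Measurable (gridIndex (m := m) N) :=
  measurable_pi_lambda _ fun i => Int.measurable_floor.comp ((measurable_pi_apply i).const_mul _)

lemma gridCube_eq_pi {N : ℕ} (hN : 0 < N) (z : Fin m → ℤ) :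
    gridCube N z = Set.univ.pi fun i => Set.Ico ((z i : ℝ) / N) ((z i : ℝ) / N + 1 / N) := by
  have hN' : (0 : ℝ) < N := Nat.cast_pos.2 hN
  ext x
  simp only [gridCube, gridIndex, Set.mem_preimage, Set.mem_singleton_iff, funext_iff,
    Set.mem_univ_pi, Set.mem_Ico, Int.floor_eq_iff, ← add_div, div_le_iff₀' hN', lt_div_iff₀' hN']

lemma volume_gridCube {N : ℕ} (hN : 0 < N) (z : Fin m → ℤ) :
    volume (gridCube N z) = ENNReal.ofReal (1 / N) ^ m := by
  rw [gridCube_eq_pi hN, Real.volume_pi_Ico]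
  simp

/-- Distances are taken in the sup norm of `Fin m → ℝ`, so no dimensional constant appears. The ball
can be open because the cubes are half-open. -/
lemma gridCube_subset_ball {N : ℕ} (hN : 0 < N) (x : Fin m → ℝ) :
    gridCube N (gridIndex N x) ⊆ Metric.ball x (1 / N) := by
  have hN' : (0 : ℝ) < 1 / N := one_div_pos.2 (Nat.cast_pos.2 hN)
  intro y hy
  have hx : x ∈ gridCube N (gridIndex N x) := rfl
  rw [gridCube_eq_pi hN, Set.mem_univ_pi] at hx hy
  rw [Metric.mem_ball, dist_pi_lt_iff hN']
  intro i
  have h1 := hx i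
  have h2 := hy i
  rw [Set.mem_Ico] at h1 h2
  rw [Real.dist_eq, abs_lt]
  constructor <;> linarith

/-- The averages of `f` over the cubes of the grid of mesh `1 / N`. -/
def gridAverage (N : ℕ) (f : (Fin m → ℝ) → ℝ) (z : Fin m → ℤ) : ℝ := ⨍ y in gridCube N z, f y

lemma enorm_gridAverage_le {N : ℕ} (hN : 0 < N) (f : (Fin m → ℝ) → ℝ) (z : Fin m → ℤ) :
    ‖gridAverage N f z‖ₑ ≤ (ENNReal.ofReal (1 / N) ^ m)⁻¹ * ∫⁻ y, ‖f y‖ₑ := by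
  rw [gridAverage, average]
  refine (enorm_integral_le_lintegral_enorm _).trans ?_
  rw [lintegral_smul_measure, Measure.restrict_apply_univ, volume_gridCube hN]
  exact mul_le_mul_right (setLIntegral_le_lintegral _ _) _

/-- The difference is the average of `f y - f x` over the cube around `x`. Enlarging the cube to a
ball centred at `x` makes the domain of `h` independent of `x`, which prepares the exchange of
integrals; the prefactor remains the inverse volume of the cube. -/
lemma enorm_sub_gridAverage_le {N : ℕ} (hN : 0 < N) {f : (Fin m → ℝ) → ℝ} (hf : Continuous f)
    (x : Fin m → ℝ) :
    ‖f x - gridAverage N f (gridIndex N x)‖ₑ ≤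
      (ENNReal.ofReal (1 / N) ^ m)⁻¹ *
        ∫⁻ h in Metric.ball (0 : Fin m → ℝ) (1 / N), ‖f (x + h) - f x‖ₑ := by
  have hN' : (0 : ℝ) < 1 / N := one_div_pos.2 (Nat.cast_pos.2 hN)
  set Q := gridCube N (gridIndex N x) with hQ
  have hvol : volume Q = ENNReal.ofReal (1 / N) ^ m := volume_gridCube hN _
  have h0 : volume Q ≠ 0 := by
    rw [hvol]
    exact pow_ne_zero _ (ENNReal.ofReal_pos.2 hN').ne'
  have ht : volume Q ≠ ⊤ := by
    rw [hvol]
    exact ENNReal.pow_ne_top ENNReal.ofReal_ne_top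
  have hfQ : IntegrableOn f Q volume :=
    (hf.continuousOn.integrableOn_compact (isCompact_closedBall x (1 / N))).mono_set
      ((gridCube_subset_ball hN x).trans Metric.ball_subset_closedBall)
  have hsub : gridAverage N f (gridIndex N x) - f x = ⨍ y in Q, (f y - f x) := by
    rw [setAverage_eq, integral_sub hfQ (integrableOn_const ht), smul_sub, ← setAverage_eq,
      ← setAverage_eq, setAverage_const h0 ht]
    rfl
  rw [← enorm_neg, neg_sub, hsub, average]
  refine (enorm_integral_le_lintegral_enorm _).trans ?_
  rw [lintegral_smul_measure, Measure.restrict_apply_univ, hvol, smul_eq_mul]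
  refine mul_le_mul_right ?_ _
  calc ∫⁻ y in Q, ‖f y - f x‖ₑ ≤ ∫⁻ y in Metric.ball x (1 / N), ‖f y - f x‖ₑ :=
        lintegral_mono_set (gridCube_subset_ball hN x)
    _ = ∫⁻ h in Metric.ball (0 : Fin m → ℝ) (1 / N), ‖f (x + h) - f x‖ₑ := by
        rw [← lintegral_indicator measurableSet_ball, ← lintegral_indicator measurableSet_ball,
          ← lintegral_add_left_eq_self _ x]
        refine lintegral_congr fun h => ?_
        simp [Set.indicator]

/-- A Poincaré inequality for the grid: after the exchange of integrals, each translation by `h`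
with `‖h‖ < 1 / N` costs at most `1 / N` times the `L¹`-norm of the derivative. -/
lemma lintegral_enorm_sub_gridAverage_le {N : ℕ} (hN : 0 < N) {f : (Fin m → ℝ) → ℝ}
    (hf : ContDiff ℝ 1 f) :
    ∫⁻ x, ‖f x - gridAverage N f (gridIndex N x)‖ₑ ≤
      2 ^ m * ENNReal.ofReal (1 / N) * ∫⁻ x, ‖fderiv ℝ f x‖ₑ := by
  have hN' : (0 : ℝ) < 1 / N := one_div_pos.2 (Nat.cast_pos.2 hN)
  set r : ℝ := 1 / N
  have hr0 : ENNReal.ofReal r ^ m ≠ 0 := pow_ne_zero _ (ENNReal.ofReal_pos.2 hN').ne'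
  have hrt : ENNReal.ofReal r ^ m ≠ ⊤ := ENNReal.pow_ne_top ENNReal.ofReal_ne_top
  have hc : Continuous fun p : (Fin m → ℝ) × (Fin m → ℝ) => ‖f (p.1 + p.2) - f p.1‖ₑ := by
    have := hf.continuous
    fun_prop
  calc ∫⁻ x, ‖f x - gridAverage N f (gridIndex N x)‖ₑ
      ≤ ∫⁻ x, (ENNReal.ofReal r ^ m)⁻¹ *
        ∫⁻ h in Metric.ball (0 : Fin m → ℝ) r, ‖f (x + h) - f x‖ₑ :=
        lintegral_mono (enorm_sub_gridAverage_le hN hf.continuous)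
    _ = (ENNReal.ofReal r ^ m)⁻¹ *
        ∫⁻ h in Metric.ball (0 : Fin m → ℝ) r, ∫⁻ x, ‖f (x + h) - f x‖ₑ := by
        rw [lintegral_const_mul' _ _ (ENNReal.inv_ne_top.2 hr0),
          lintegral_lintegral_swap hc.measurable.aemeasurable]
    _ ≤ (ENNReal.ofReal r ^ m)⁻¹ *
        ∫⁻ _ in Metric.ball (0 : Fin m → ℝ) r, ENNReal.ofReal r * ∫⁻ x, ‖fderiv ℝ f x‖ₑ := by
        gcongr (ENNReal.ofReal r ^ m)⁻¹ * ?_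
        refine setLIntegral_mono' measurableSet_ball fun h hh => ?_
        refine (lintegral_enorm_sub_translate_le volume hf h).trans ?_
        gcongr
        rw [← ofReal_norm]
        exact ENNReal.ofReal_le_ofReal (mem_ball_zero_iff.1 hh).le
    _ = 2 ^ m * ENNReal.ofReal r * ∫⁻ x, ‖fderiv ℝ f x‖ₑ := by
        -- In the sup norm the ball of radius `r` is a cube of side `2r`; its volume divided by `r ^
        -- m` is `2 ^ m`.
        rw [setLIntegral_const, Real.volume_pi_ball _ hN', Fintype.card_fin, mul_pow,
          ENNReal.ofReal_mul (by positivity), ENNReal.ofReal_pow hN'.le,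
          ENNReal.ofReal_pow zero_le_two, ENNReal.ofReal_ofNat]
        rw [show ∀ a b c d e : ℝ≥0∞, a * (b * c * (d * e)) = (a * e) * (d * b * c) by
          intros; ring, ENNReal.inv_mul_cancel hr0 hrt, one_mul]

/-- If all averages over grid cubes converge along a sequence which is bounded in `W^{1,1}`, then
the sequence is locally Cauchy in `L¹`. -/
lemma eventually_eLpNorm_sub_lt {f : ℕ → (Fin m → ℝ) → ℝ} (hf : ∀ n, ContDiff ℝ 1 (f n))
    {C : ℝ≥0∞} (hC : C ≠ ⊤) (h0 : ∀ n, ∫⁻ x, ‖f n x‖ₑ ≤ C)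
    (h1 : ∀ n, ∫⁻ x, ‖fderiv ℝ (f n) x‖ₑ ≤ C) {a : ℕ → (Fin m → ℤ) → ℝ}
    (ha : ∀ N > 0, ∀ z, Tendsto (fun n => gridAverage N (f n) z) atTop (𝓝 (a N z)))
    {s : Set (Fin m → ℝ)} (hs : volume s ≠ ⊤) {ε : ℝ≥0∞} (hε : ε ≠ 0) :
    ∃ n₀, ∀ n ≥ n₀, ∀ k ≥ n₀, eLpNorm (f n - f k) 1 (volume.restrict s) < ε := by
  have hε4 : 0 < ε / 4 := ENNReal.div_pos hε (by simp)
  -- The mesh is fixed first, uniformly in `n`, so that replacing a function by its averages costs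
  -- less than `ε / 4`. The other quarter is for the convergence of the averages; `f n` and `f k`
  -- each use two quarters.
  obtain ⟨N, hN, hNε⟩ : ∃ N : ℕ, 0 < N ∧ 2 ^ m * ENNReal.ofReal (1 / N) * C < ε / 4 := by
    have h : Tendsto (fun N : ℕ => 2 ^ m * ENNReal.ofReal (1 / N) * C) atTop (𝓝 0) := by
      have h2 : Tendsto (fun N : ℕ => ENNReal.ofReal (1 / (N : ℝ))) atTop (𝓝 0) := by
        simpa using ENNReal.tendsto_ofReal (tendsto_one_div_atTop_nhds_zero_nat (𝕜 := ℝ))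
      simpa using ENNReal.Tendsto.mul_const
        (ENNReal.Tendsto.const_mul h2 (Or.inr (by simp : (2 : ℝ≥0∞) ^ m ≠ ⊤))) (Or.inr hC)
    exact ((eventually_gt_atTop 0).and (h.eventually_lt_const hε4)).exists
  have hmeas (b : (Fin m → ℤ) → ℝ) : Measurable fun x => b (gridIndex N x) :=
    (measurable_of_countable b).comp (measurable_gridIndex N)
  -- Dominated convergence: for the fixed mesh the averages are bounded uniformly in `n` and in the
  -- cube, and a constant is integrable over `s`.
  have hlim : Tendsto (fun n => ∫⁻ x in s,
      ‖gridAverage N (f n) (gridIndex N x) - a N (gridIndex N x)‖ₑ) atTop (𝓝 0) := by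
    have hb (n : ℕ) (z) : ‖gridAverage N (f n) z‖ₑ ≤ (ENNReal.ofReal (1 / N) ^ m)⁻¹ * C :=
      (enorm_gridAverage_le hN _ z).trans (mul_le_mul_right (h0 n) _)
    have hfin : (ENNReal.ofReal (1 / N) ^ m)⁻¹ * C ≠ ⊤ :=
      ENNReal.mul_ne_top (ENNReal.inv_ne_top.2 (pow_ne_zero _
        (ENNReal.ofReal_pos.2 (one_div_pos.2 (Nat.cast_pos.2 hN))).ne')) hC
    have := tendsto_lintegral_of_dominated_convergence (μ := volume.restrict s)
      (F := fun n x => ‖gridAverage N (f n) (gridIndex N x) - a N (gridIndex N x)‖ₑ)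
      (f := fun _ => 0) (fun _ => (ENNReal.ofReal (1 / N) ^ m)⁻¹ * C +
        (ENNReal.ofReal (1 / N) ^ m)⁻¹ * C)
      (fun n => ((hmeas _).sub (hmeas _)).enorm) ?_ ?_ ?_
    · simpa using this
    · refine fun n => Eventually.of_forall fun x => enorm_sub_le.trans
        (add_le_add (hb n _) ?_)
      exact le_of_tendsto' (ha N hN _).enorm fun k => hb k _
    · rw [setLIntegral_const]
      exact ENNReal.mul_ne_top (ENNReal.add_ne_top.2 ⟨hfin, hfin⟩) hs
    · refine Eventually.of_forall fun x => ?_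
      simpa using ((ha N hN (gridIndex N x)).sub_const (a N (gridIndex N x))).enorm
  obtain ⟨n₀, hn₀⟩ := eventually_atTop.1 (hlim.eventually_lt_const hε4)
  have hclose : ∀ n ≥ n₀, eLpNorm (fun x => f n x - a N (gridIndex N x)) 1 (volume.restrict s) <
      ε / 2 := by
    intro n hn
    have hsplit : (fun x => f n x - a N (gridIndex N x)) =
        (fun x => f n x - gridAverage N (f n) (gridIndex N x)) +
          fun x => gridAverage N (f n) (gridIndex N x) - a N (gridIndex N x) := by
      ext x
      simp
    rw [hsplit]
    refine (eLpNorm_add_le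
      ((hf n).continuous.measurable.sub (hmeas _)).aestronglyMeasurable
      ((hmeas _).sub (hmeas _)).aestronglyMeasurable le_rfl).trans_lt ?_
    rw [eLpNorm_one_eq_lintegral_enorm, eLpNorm_one_eq_lintegral_enorm]
    have h4 : ε / 2 = ε / 4 + ε / 4 := by
      rw [← ENNReal.add_div, ← two_mul, show (4 : ℝ≥0∞) = 2 * 2 by norm_num,
        ENNReal.mul_div_mul_left _ _ two_ne_zero ENNReal.ofNat_ne_top]
    rw [h4]
    refine ENNReal.add_lt_add (lt_of_le_of_lt ?_ hNε) (hn₀ n hn)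
    refine (setLIntegral_le_lintegral _ _).trans
      ((lintegral_enorm_sub_gridAverage_le hN (hf n)).trans ?_)
    gcongr
    exact h1 n
  refine ⟨n₀, fun n hn k hk => ?_⟩
  have hsplit : f n - f k = (fun x => f n x - a N (gridIndex N x)) -
      fun x => f k x - a N (gridIndex N x) := by
    ext x
    simp
  rw [hsplit, ← ENNReal.add_halves ε]
  exact (eLpNorm_sub_le ((hf n).continuous.measurable.sub (hmeas _)).aestronglyMeasurable
    ((hf k).continuous.measurable.sub (hmeas _)).aestronglyMeasurable le_rfl).trans_lt
    (ENNReal.add_lt_add (hclose n hn) (hclose k hk))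

/-- **Rellich's theorem** in `ℝᵐ`: a sequence that is bounded in `W^{1,1}` has a subsequence that
converges almost everywhere on a given set of finite measure. -/
theorem exists_subseq_ae_tendsto_of_contDiff {f : ℕ → (Fin m → ℝ) → ℝ}
    (hf : ∀ n, ContDiff ℝ 1 (f n)) {C : ℝ≥0∞} (hC : C ≠ ⊤) (h0 : ∀ n, ∫⁻ x, ‖f n x‖ₑ ≤ C)
    (h1 : ∀ n, ∫⁻ x, ‖fderiv ℝ (f n) x‖ₑ ≤ C) {s : Set (Fin m → ℝ)} (hs : volume s ≠ ⊤) :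
    ∃ φ : ℕ → ℕ, StrictMono φ ∧
      ∀ᵐ x ∂(volume.restrict s), ∃ l, Tendsto (fun n => f (φ n) x) atTop (𝓝 l) := by
  let B (N : ℕ) : ℝ := ((ENNReal.ofReal (1 / N) ^ m)⁻¹ * C).toReal
  -- The first index is shifted by one so that only meshes `1 / N` with `N > 0` occur.
  have hmem : ∀ n, (fun p : ℕ × (Fin m → ℤ) => gridAverage (p.1 + 1) (f n) p.2) ∈
      Set.univ.pi fun p : ℕ × (Fin m → ℤ) => Metric.closedBall (0 : ℝ) (B (p.1 + 1)) := by
    intro n p _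
    have hp : (0 : ℝ) < 1 / ((p.1 + 1 : ℕ) : ℝ) := by positivity
    rw [mem_closedBall_zero_iff, ← toReal_enorm]
    refine ENNReal.toReal_mono (ENNReal.mul_ne_top (ENNReal.inv_ne_top.2 (pow_ne_zero _
      (ENNReal.ofReal_pos.2 hp).ne')) hC) ?_
    exact (enorm_gridAverage_le p.1.succ_pos _ _).trans (mul_le_mul_right (h0 n) _)
  -- There are countably many cubes over all meshes, so the product of the compact intervals is
  -- sequentially compact, and a single subsequence serves all the averages.
  obtain ⟨a, -, φ, hφ, hlim⟩ :=
    (isCompact_univ_pi fun p : ℕ × (Fin m → ℤ) =>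
      isCompact_closedBall (0 : ℝ) (B (p.1 + 1))).tendsto_subseq hmem
  rw [tendsto_pi_nhds] at hlim
  have ha : ∀ N > 0, ∀ z, Tendsto (fun n => gridAverage N (f (φ n)) z) atTop
      (𝓝 (a (N - 1, z))) := by
    intro N hN z
    have := hlim (N - 1, z)
    simpa only [Function.comp_def, Nat.sub_add_cancel hN] using this
  -- A further subsequence with `L¹`-distances below the summable `2⁻¹ ^ j` converges almost
  -- everywhere.
  have hcau (j : ℕ) : ∀ᶠ n₀ in atTop, ∀ n ≥ n₀, ∀ k ≥ n₀,
      eLpNorm (f (φ n) - f (φ k)) 1 (volume.restrict s) < 2⁻¹ ^ j := by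
    obtain ⟨n₀, hn₀⟩ := eventually_eLpNorm_sub_lt (fun n => hf (φ n)) hC (fun n => h0 (φ n))
      (fun n => h1 (φ n)) (a := fun N z => a (N - 1, z)) ha hs (ε := 2⁻¹ ^ j) (by simp)
    filter_upwards [eventually_ge_atTop n₀] with n₁ hn₁ n hn k hk
    exact hn₀ n (hn₁.trans hn) k (hn₁.trans hk)
  obtain ⟨ψ, hψ, hψlt⟩ := extraction_forall_of_eventually hcau
  refine ⟨φ ∘ ψ, hφ.comp hψ, ?_⟩
  refine Lp.ae_tendsto_of_cauchy_eLpNorm (p := 1) (B := fun j => 2⁻¹ ^ j)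
    (fun n => (hf _).continuous.aestronglyMeasurable) le_rfl ?_ ?_
  · rw [ENNReal.tsum_geometric]
    simp
  · intro j n k hn hk
    exact hψlt j _ (hψ.monotone hn) _ (hψ.monotone hk)

end Rellich

/-! ### The Riemannian measure in charts -/

section Chart

variable {m : ℕ}
  {M : Type*} [TopologicalSpace M] [SecondCountableTopology M]
  [ChartedSpace (EuclideanSpace ℝ (Fin m)) M] [IsManifold (𝓡 m) ∞ M]
  [RiemannianBundle (fun x : M => TangentSpace (𝓡 m) x)]
  [IsContMDiffRiemannianBundle (𝓡 m) ∞ (EuclideanSpace ℝ (Fin m))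
    (fun x : M => TangentSpace (𝓡 m) x)]
  [MeasurableSpace M] [BorelSpace M]

local notation "𝔼" => EuclideanSpace ℝ (Fin m)

/-- The coordinate fields are the frame of the tangent bundle trivialization at `x₀`. Their
continuity and linear independence are inherited from the bundle. -/
lemma coordVector_eq_symm (x₀ : M) {y : 𝔼} (hy : y ∈ (chartAt 𝔼 x₀).target) (i : Fin m) :
    coordVector (chartAt 𝔼 x₀) i y =
      (trivializationAt 𝔼 (fun x : M => TangentSpace (𝓡 m) x) x₀).symmL ℝ
        ((chartAt 𝔼 x₀).symm y) (EuclideanSpace.single i (1 : ℝ)) := by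
  have hx : (chartAt 𝔼 x₀).symm y ∈ (chartAt 𝔼 x₀).source := (chartAt 𝔼 x₀).map_target hy
  rw [TangentBundle.symmL_trivializationAt (I := 𝓡 m) hx]
  simp only [coordVector, mfld_simps, mfderivWithin_univ]
  exact (congrArg (fun z : 𝔼 => (mfderiv (𝓡 m) (𝓡 m) (chartAt 𝔼 x₀).symm z : 𝔼 →L[ℝ] 𝔼)
    (EuclideanSpace.single i 1)) ((chartAt 𝔼 x₀).right_inv hy)).symm

/-- Near the centre of a chart, the coordinate vector fields are bounded and the density of the
Riemannian measure is bounded below. -/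
lemma exists_bounds_coordVector (x₀ : M) :
    ∃ c > 0, ∃ C : ℝ, ∀ᶠ y in 𝓝 (chartAt 𝔼 x₀ x₀), y ∈ (chartAt 𝔼 x₀).target ∧
      c ≤ √(chartGram (chartAt 𝔼 x₀) y).det ∧
      ∀ i, ‖coordVector (chartAt 𝔼 x₀) i y‖ ≤ C := by
  have hR := isContinuousRiemannianBundle_of_smooth (F := 𝔼)
    (V := fun x : M => TangentSpace (𝓡 m) x) m
  set e := chartAt 𝔼 x₀ with he
  set t := trivializationAt 𝔼 (fun x : M => TangentSpace (𝓡 m) x) x₀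
  have hx₀ : x₀ ∈ e.source := mem_chart_source 𝔼 x₀
  have hy₀ : e x₀ ∈ e.target := e.map_source hx₀
  have htarget : ∀ᶠ y in 𝓝 (e x₀), y ∈ e.target := e.open_target.mem_nhds hy₀
  have hbase : ∀ y ∈ e.target, e.symm y ∈ t.baseSet := fun y hy => e.map_target hy
  have hcv (i : Fin m) : ContinuousAt
      (fun y => (⟨e.symm y, coordVector e i y⟩ : TotalSpace 𝔼 fun x : M => TangentSpace (𝓡 m) x))
      (e x₀) := by
    have h1 : ContinuousOn (fun y => (⟨e.symm y, t.symm (e.symm y) (EuclideanSpace.single i 1)⟩ :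
        TotalSpace 𝔼 fun x : M => TangentSpace (𝓡 m) x)) e.target :=
      t.continuousOn_symm.comp (f := fun y => (e.symm y, EuclideanSpace.single i (1 : ℝ)))
        (e.continuousOn_symm.prodMk continuousOn_const) fun y hy => ⟨hbase y hy, trivial⟩
    refine (h1.continuousAt htarget).congr ?_
    filter_upwards [htarget] with y hy
    rw [he, coordVector_eq_symm x₀ hy, Trivialization.symmL_apply t (hbase y hy)]
  have hG : ContinuousAt (chartGram e) (e x₀) :=
    continuousAt_pi.2 fun i => continuousAt_pi.2 fun j =>
      ContinuousAt.inner_bundle (F := 𝔼) (E := fun x : M => TangentSpace (𝓡 m) x)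
        (b := fun y => e.symm y) (hcv i) (hcv j)
  have hdet : ContinuousAt (fun y => √(chartGram e y).det) (e x₀) :=
    Real.continuous_sqrt.continuousAt.comp
      ((continuous_id.matrix_det (A := fun A : Matrix (Fin m) (Fin m) ℝ => A)).continuousAt.comp hG)
  have hpos : 0 < √(chartGram e (e x₀)).det := by
    have hfun : (fun i => coordVector e i (e x₀)) =
        (EuclideanSpace.basisFun (Fin m) ℝ).toBasis.map
          (t.linearEquivAt (R := ℝ) _ (hbase _ hy₀)).symm := by
      ext1 i
      refine (coordVector_eq_symm x₀ hy₀ i).trans ?_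
      simp only [Module.Basis.map_apply, OrthonormalBasis.coe_toBasis,
        EuclideanSpace.basisFun_apply]
      exact Trivialization.symmL_apply t (hbase _ hy₀) _
    have hli : LinearIndependent ℝ fun i => coordVector e i (e x₀) := by
      rw [hfun]
      exact Module.Basis.linearIndependent _
    exact Real.sqrt_pos.2 (Matrix.posDef_gram_of_linearIndependent (𝕜 := ℝ) hli).det_pos
  have hnorm (i : Fin m) : ∀ᶠ y in 𝓝 (e x₀), ‖coordVector e i y‖ <
      ‖coordVector e i (e x₀)‖ + 1 := by
    have h : ContinuousAt (fun y => ‖coordVector e i y‖) (e x₀) :=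
      (continuous_fiber_norm 𝔼 fun x : M => TangentSpace (𝓡 m) x).continuousAt.comp (hcv i)
    exact h.eventually_lt_const (lt_add_one _)
  -- The density is continuous and positive at the centre, so half of its value there is a lower
  -- bound nearby. The sum over `i` bounds each of its terms.
  refine ⟨_, half_pos hpos, ∑ i, (‖coordVector e i (e x₀)‖ + 1), ?_⟩
  filter_upwards [htarget, hdet.eventually_const_lt (half_lt_self hpos),
    eventually_all.2 hnorm] with y h1 h2 h3
  refine ⟨h1, h2.le, fun i => (h3 i).le.trans ?_⟩
  exact Finset.single_le_sum (f := fun i => ‖coordVector e i (e x₀)‖ + 1)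
    (fun i _ => by positivity) (Finset.mem_univ i)

lemma chartVolume_le_riemannianVolume (x₀ : M) :
    chartVolume (chartAt 𝔼 x₀) ≤ riemannianVolume m M :=
  le_iSup₂_of_le (chartAt 𝔼 x₀) (chart_mem_atlas 𝔼 x₀) le_rfl

lemma aemeasurable_chart_symm (e : OpenPartialHomeomorph M 𝔼) :
    AEMeasurable e.symm (volume.restrict e.target) :=
  e.continuousOn_symm.aemeasurable e.open_target.measurableSet

/-- On `s` the measure `c dx` lies below the density measure of the chart, whose image on `M` lies
below the supremum defining the Riemannian measure. Only these inequalities enter, not the agreement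
of chart measures on overlaps. -/
lemma setLIntegral_comp_chart_symm_le (x₀ : M) {s : Set 𝔼} (hs : MeasurableSet s)
    (hst : s ⊆ (chartAt 𝔼 x₀).target) {c : ℝ} (hc : 0 < c)
    (hcs : ∀ y ∈ s, c ≤ √(chartGram (chartAt 𝔼 x₀) y).det) {h : M → ℝ≥0∞} (hh : Measurable h) :
    ∫⁻ y in s, h ((chartAt 𝔼 x₀).symm y) ≤
      (ENNReal.ofReal c)⁻¹ * ∫⁻ x, h x ∂(riemannianVolume m M) := by
  set e := chartAt 𝔼 x₀
  set ρ : 𝔼 → ℝ≥0∞ := fun y => ENNReal.ofReal √(chartGram e y).det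
  have hle : ENNReal.ofReal c • volume.restrict s ≤ (volume.restrict e.target).withDensity ρ := by
    refine Measure.le_iff.2 fun A hA => ?_
    rw [withDensity_apply _ hA, Measure.smul_apply, Measure.restrict_apply hA,
      Measure.restrict_restrict hA, smul_eq_mul, ← setLIntegral_const]
    calc ∫⁻ _ in A ∩ s, ENNReal.ofReal c ≤ ∫⁻ y in A ∩ s, ρ y :=
          setLIntegral_mono' (hA.inter hs) fun y hy => ENNReal.ofReal_le_ofReal (hcs y hy.2)
      _ ≤ ∫⁻ y in A ∩ e.target, ρ y :=
          lintegral_mono_set (Set.inter_subset_inter_right A hst)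
  have hae : AEMeasurable e.symm ((volume.restrict e.target).withDensity ρ) :=
    (aemeasurable_chart_symm e).mono_ac (withDensity_absolutelyContinuous _ _)
  have hc0 : ENNReal.ofReal c ≠ 0 := (ENNReal.ofReal_pos.2 hc).ne'
  rw [← one_mul (∫⁻ y in s, _), ← ENNReal.inv_mul_cancel hc0 ENNReal.ofReal_ne_top, mul_assoc]
  refine mul_le_mul_right ?_ _
  calc ENNReal.ofReal c * ∫⁻ y in s, h (e.symm y)
      = ∫⁻ y, h (e.symm y) ∂(ENNReal.ofReal c • volume.restrict s) := by
        rw [lintegral_smul_measure, smul_eq_mul]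
    _ ≤ ∫⁻ y, h (e.symm y) ∂((volume.restrict e.target).withDensity ρ) :=
        lintegral_mono' hle le_rfl
    _ = ∫⁻ x, h x ∂(chartVolume e) := (lintegral_map' hh.aemeasurable hae).symm
    _ ≤ ∫⁻ x, h x ∂(riemannianVolume m M) :=
        lintegral_mono' (chartVolume_le_riemannianVolume x₀) le_rfl

/-- Lebesgue null sets in a chart are null sets for the Riemannian measure. -/
lemma riemannianVolume_preimage_chart_eq_zero (x₀ : M) {A : Set 𝔼} (hA : MeasurableSet A)
    (hA0 : volume A = 0) :
    riemannianVolume m M ((chartAt 𝔼 x₀).source ∩ chartAt 𝔼 x₀ ⁻¹' A) = 0 := by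
  set e := chartAt 𝔼 x₀
  have hB : MeasurableSet (e.source ∩ e ⁻¹' A) := by
    have : e.source ∩ e ⁻¹' A = Subtype.val '' ((fun x : e.source => e x) ⁻¹' A) := by
      ext x
      simp [and_comm]
    rw [this]
    exact e.open_source.measurableSet.subtype_image
      ((continuousOn_iff_continuous_domRestrict.1 e.continuousOn).measurable hA)
  -- In any other chart the set is contained in the image of a null set under the transition map,
  -- which is differentiable and so preserves null sets.
  have hnull : ∀ e' ∈ atlas 𝔼 M, chartVolume e' (e.source ∩ e ⁻¹' A) = 0 := by
    intro e' he'
    have hae : AEMeasurable e'.symm ((volume.restrict e'.target).withDensity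
        fun y => ENNReal.ofReal √(chartGram e' y).det) :=
      (aemeasurable_chart_symm e').mono_ac (withDensity_absolutelyContinuous _ _)
    rw [chartVolume, Measure.map_apply_of_aemeasurable hae hB]
    refine withDensity_absolutelyContinuous _ _ ?_
    rw [Measure.restrict_apply₀' e'.open_target.measurableSet.nullMeasurableSet]
    have hsub : e'.symm ⁻¹' (e.source ∩ e ⁻¹' A) ∩ e'.target ⊆
        (e.symm.trans e') '' (A ∩ (e.symm.trans e').source) := by
      rintro y ⟨⟨hy1, hy2⟩, hy3⟩
      refine ⟨e (e'.symm y), ⟨hy2, ?_⟩, ?_⟩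
      · rw [OpenPartialHomeomorph.trans_source]
        refine ⟨e.map_source hy1, ?_⟩
        rw [Set.mem_preimage, e.left_inv hy1]
        exact e'.map_target hy3
      · rw [OpenPartialHomeomorph.coe_trans, Function.comp_apply, e.left_inv hy1,
          e'.right_inv hy3]
    refine measure_mono_null hsub ?_
    have hdiff : DifferentiableOn ℝ (e.symm.trans e') (e.symm.trans e').source :=
      (contMDiffOn_iff_contDiffOn.1 (contMDiffOn_of_mem_contDiffGroupoid
        ((contDiffGroupoid ∞ (𝓡 m)).compatible (chart_mem_atlas 𝔼 x₀) he'))).differentiableOn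
        (by simp)
    exact addHaar_image_eq_zero_of_differentiableOn_of_addHaar_eq_zero volume
      (hdiff.mono Set.inter_subset_right) (measure_mono_null Set.inter_subset_left hA0)
  -- A supremum of measures is not computed set by set. Instead, every chart measure lies below the
  -- restriction of the Riemannian measure to the complement, hence so does their supremum.
  have hle : riemannianVolume m M ≤ (riemannianVolume m M).restrict (e.source ∩ e ⁻¹' A)ᶜ := by
    refine iSup₂_le fun e' he' => ?_
    have : chartVolume e' = (chartVolume e').restrict (e.source ∩ e ⁻¹' A)ᶜ :=
      (Measure.restrict_eq_self_of_ae_mem (measure_eq_zero_iff_ae_notMem.1 (hnull e' he'))).symm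
    rw [this]
    exact Measure.restrict_mono_measure (le_iSup₂_of_le e' he' le_rfl) _
  refine le_antisymm ((hle _).trans ?_) zero_le
  rw [Measure.restrict_apply hB]
  simp

end Chart

/-! ### Continuity of `|∇σ|` -/

section ContinuousHSNorm

variable {𝕜 : Type*} [RCLike 𝕜] {m : ℕ}
  {M : Type*} [TopologicalSpace M] [SecondCountableTopology M]
  [ChartedSpace (EuclideanSpace ℝ (Fin m)) M] [IsManifold (𝓡 m) ∞ M]
  [RiemannianBundle (fun x : M => TangentSpace (𝓡 m) x)]
  [IsContMDiffRiemannianBundle (𝓡 m) ∞ (EuclideanSpace ℝ (Fin m))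
    (fun x : M => TangentSpace (𝓡 m) x)]
  [MeasurableSpace M] [BorelSpace M]
  {F : Type*} [NormedAddCommGroup F] [NormedSpace ℝ F] [NormedSpace 𝕜 F] [IsScalarTower ℝ 𝕜 F]
  [FiniteDimensional ℝ F]
  {V : M → Type*} [TopologicalSpace (TotalSpace F V)]
  [∀ x, NormedAddCommGroup (V x)] [∀ x, InnerProductSpace ℝ (V x)]
  [∀ x, InnerProductSpace 𝕜 (V x)] [∀ x, IsScalarTower ℝ 𝕜 (V x)]
  [FiberBundle F V] [VectorBundle ℝ F V] [VectorBundle 𝕜 F V]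
  [ContMDiffVectorBundle ∞ F V (𝓡 m)] [IsContMDiffRiemannianBundle (𝓡 m) ∞ F V]

lemma continuous_hsNorm_of_continuous {w : ∀ x : M, TangentSpace (𝓡 m) x →L[ℝ] V x}
    (hw : Continuous fun x => (⟨x, w x⟩ : TotalSpace (EuclideanSpace ℝ (Fin m) →L[ℝ] F)
      fun x : M => TangentSpace (𝓡 m) x →L[ℝ] V x)) : Continuous fun x => hsNorm (w x) := by
  have := isContinuousRiemannianBundle_of_smooth (F := F) (V := V) m
  have := isContinuousRiemannianBundle_of_smooth (F := EuclideanSpace ℝ (Fin m))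
    (V := fun x : M => TangentSpace (𝓡 m) x) m
  have h := (continuous_fiber_hsNorm F V (fun x : M => TangentSpace (𝓡 m) x)
    (EuclideanSpace ℝ (Fin m))).comp hw
  exact h

lemma MetricConnection.continuous_covariantDerivative (D : MetricConnection 𝕜 m F V)
    {σ : ∀ x, V x} (hσ : SmoothSection m F σ) :
    Continuous fun x => (⟨x, D.toCovariantDerivative σ x⟩ :
      TotalSpace (EuclideanSpace ℝ (Fin m) →L[ℝ] F)
        fun x : M => TangentSpace (𝓡 m) x →L[ℝ] V x) := by
  have h := D.contMDiff.contMDiff.contMDiff (σ := σ) (contMDiffOn_univ.2 (by exact hσ))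
  exact (contMDiffOn_univ.1 h).continuous

lemma MetricConnection.continuous_hsNorm (D : MetricConnection 𝕜 m F V) {σ : ∀ x, V x}
    (hσ : SmoothSection m F σ) : Continuous fun x => hsNorm (D.toCovariantDerivative σ x) := by
  have h := continuous_hsNorm_of_continuous (D.continuous_covariantDerivative hσ)
  exact h

end ContinuousHSNorm

/-! ### Rellich's theorem in a chart -/

section LocalRellich

variable {m : ℕ}
  {M : Type*} [TopologicalSpace M] [SecondCountableTopology M]
  [ChartedSpace (EuclideanSpace ℝ (Fin m)) M] [IsManifold (𝓡 m) ∞ M]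
  [RiemannianBundle (fun x : M => TangentSpace (𝓡 m) x)]
  [IsContMDiffRiemannianBundle (𝓡 m) ∞ (EuclideanSpace ℝ (Fin m))
    (fun x : M => TangentSpace (𝓡 m) x)]
  [MeasurableSpace M] [BorelSpace M]

local notation "𝔼" => EuclideanSpace ℝ (Fin m)

lemma continuous_hsNorm_mvfderiv {f : M → ℝ} (hf : ContMDiff (𝓡 m) 𝓘(ℝ, ℝ) ∞ f) :
    Continuous fun x => hsNorm (mvfderiv (𝓡 m) f x) :=
  (trivialConnection m M).continuous_hsNorm (σ := f) fun x => (contMDiffAt_section _).2 (hf x)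

/-- The expression of `f : M → ℝ` in the chart centred at `x₀`, extended by zero. -/
def chartExpression (x₀ : M) (f : M → ℝ) : 𝔼 → ℝ :=
  (chartAt 𝔼 x₀).target.indicator fun y => f ((chartAt 𝔼 x₀).symm y)

lemma chartExpression_apply {x₀ : M} (f : M → ℝ) {x : M} (hx : x ∈ (chartAt 𝔼 x₀).source) :
    chartExpression x₀ f (chartAt 𝔼 x₀ x) = f x := by
  rw [chartExpression, Set.indicator_of_mem ((chartAt 𝔼 x₀).map_source hx),
    (chartAt 𝔼 x₀).left_inv hx]

lemma chartExpression_eq_zero {x₀ : M} {f : M → ℝ} {K : Set M} (hfK : ∀ x ∉ K, f x = 0) {y : 𝔼}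
    (hy : y ∉ chartAt 𝔼 x₀ '' K) : chartExpression x₀ f y = 0 := by
  refine Set.indicator_apply_eq_zero.2 fun hyt => hfK _ fun hK => hy ⟨_, hK, ?_⟩
  exact (chartAt 𝔼 x₀).right_inv hyt

lemma chartExpression_eventuallyEq {x₀ : M} (f : M → ℝ) {y : 𝔼}
    (hy : y ∈ (chartAt 𝔼 x₀).target) :
    chartExpression x₀ f =ᶠ[𝓝 y] f ∘ (chartAt 𝔼 x₀).symm := by
  filter_upwards [(chartAt 𝔼 x₀).open_target.mem_nhds hy] with z hz
  exact Set.indicator_of_mem hz _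

lemma isCompact_chart_image {x₀ : M} {K : Set M} (hK : IsCompact K)
    (hKs : K ⊆ (chartAt 𝔼 x₀).source) : IsCompact (chartAt 𝔼 x₀ '' K) :=
  hK.image_of_continuousOn ((chartAt 𝔼 x₀).continuousOn.mono hKs)

lemma chartExpression_eventuallyEq_zero {x₀ : M} {f : M → ℝ} {K : Set M} (hK : IsCompact K)
    (hKs : K ⊆ (chartAt 𝔼 x₀).source) (hfK : ∀ x ∉ K, f x = 0) {y : 𝔼}
    (hy : y ∉ chartAt 𝔼 x₀ '' K) : chartExpression x₀ f =ᶠ[𝓝 y] 0 := by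
  filter_upwards [(isCompact_chart_image hK hKs).isClosed.isOpen_compl.mem_nhds hy] with z hz
  exact chartExpression_eq_zero hfK hz

/-- At points of the image of `K` the expression agrees locally with `f` read in the chart.
Elsewhere it vanishes locally, since the compact image of `K` is closed. -/
lemma contDiff_chartExpression {x₀ : M} {f : M → ℝ} (hf : ContMDiff (𝓡 m) 𝓘(ℝ, ℝ) ∞ f)
    {K : Set M} (hK : IsCompact K) (hKs : K ⊆ (chartAt 𝔼 x₀).source)
    (hfK : ∀ x ∉ K, f x = 0) : ContDiff ℝ 1 (chartExpression (m := m) x₀ f) := by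
  refine contDiff_iff_contDiffAt.2 fun y => ?_
  by_cases hy : y ∈ chartAt 𝔼 x₀ '' K
  · have hyt : y ∈ (chartAt 𝔼 x₀).target := by
      obtain ⟨x, hx, rfl⟩ := hy
      exact (chartAt 𝔼 x₀).map_source (hKs hx)
    have hsymm : ContMDiffAt (𝓡 m) (𝓡 m) ∞ (chartAt 𝔼 x₀).symm y :=
      (contMDiffOn_chart_symm (n := ∞) (I := 𝓡 m) y hyt).contMDiffAt
        ((chartAt 𝔼 x₀).open_target.mem_nhds hyt)
    have h1 : ContMDiffAt (𝓡 m) 𝓘(ℝ, ℝ) ∞ (f ∘ (chartAt 𝔼 x₀).symm) y := (hf _).comp y hsymm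
    exact ((contMDiffAt_iff_contDiffAt.1 h1).of_le (by simp)).congr_of_eventuallyEq
      (chartExpression_eventuallyEq f hyt)
  · exact contDiffAt_const.congr_of_eventuallyEq (chartExpression_eventuallyEq_zero hK hKs hfK hy)

lemma fderiv_chartExpression {x₀ : M} {f : M → ℝ} (hf : ContMDiff (𝓡 m) 𝓘(ℝ, ℝ) ∞ f) {y : 𝔼}
    (hy : y ∈ (chartAt 𝔼 x₀).target) (i : Fin m) :
    fderiv ℝ (chartExpression x₀ f) y (EuclideanSpace.single i 1) =
      mvfderiv (𝓡 m) f ((chartAt 𝔼 x₀).symm y) (coordVector (chartAt 𝔼 x₀) i y) := by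
  rw [(chartExpression_eventuallyEq f hy).fderiv_eq, ← mfderiv_eq_fderiv]
  have hsymm : MDifferentiableAt (𝓡 m) (𝓡 m) (chartAt 𝔼 x₀).symm y :=
    (((contMDiffOn_chart_symm (n := ∞) (I := 𝓡 m)) y hy).contMDiffAt
      ((chartAt 𝔼 x₀).open_target.mem_nhds hy)).mdifferentiableAt (by simp)
  exact mfderiv_comp_apply (I := 𝓡 m) (I' := 𝓡 m) (I'' := 𝓘(ℝ, ℝ)) y
    (hf.mdifferentiable (by simp) _) hsymm _

lemma opNorm_le_sum_single (L : (Fin m → ℝ) →L[ℝ] ℝ) : ‖L‖ ≤ ∑ i, ‖L (Pi.single i 1)‖ := by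
  refine L.opNorm_le_bound (Finset.sum_nonneg fun _ _ => norm_nonneg _) fun y => ?_
  conv_lhs => rw [pi_eq_sum_univ' y, _root_.map_sum]
  rw [Finset.sum_mul]
  refine (norm_sum_le _ _).trans (Finset.sum_le_sum fun i _ => ?_)
  rw [_root_.map_smul, norm_smul, mul_comm]
  exact mul_le_mul_of_nonneg_left (norm_le_pi_norm y i) (norm_nonneg _)

/-- The grid argument lives in the sup norm, where the norm of a functional is at most the sum of
its `m` values on the standard basis. Each value is `df` on a coordinate vector of length at most
`C`. -/
lemma norm_fderiv_chartExpression_comp_le {x₀ : M} {f : M → ℝ}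
    (hf : ContMDiff (𝓡 m) 𝓘(ℝ, ℝ) ∞ f) {y : Fin m → ℝ}
    (hy : WithLp.toLp 2 y ∈ (chartAt 𝔼 x₀).target)
    (hd : DifferentiableAt ℝ (chartExpression x₀ f) (WithLp.toLp 2 y)) {C : ℝ}
    (hC : ∀ i, ‖coordVector (chartAt 𝔼 x₀) i (WithLp.toLp 2 y)‖ ≤ C) :
    ‖fderiv ℝ (fun z : Fin m → ℝ => chartExpression x₀ f (WithLp.toLp 2 z)) y‖ ≤
      m * C * hsNorm (mvfderiv (𝓡 m) f ((chartAt 𝔼 x₀).symm (WithLp.toLp 2 y))) := by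
  have hcomp : fderiv ℝ (fun z : Fin m → ℝ => chartExpression x₀ f (WithLp.toLp 2 z)) y =
      (fderiv ℝ (chartExpression x₀ f) (WithLp.toLp 2 y)).comp
        (PiLp.continuousLinearEquiv 2 ℝ fun _ : Fin m => ℝ).symm.toContinuousLinearMap :=
    (hd.hasFDerivAt.comp y
      (PiLp.continuousLinearEquiv 2 ℝ fun _ : Fin m => ℝ).symm.hasFDerivAt).fderiv
  refine (opNorm_le_sum_single _).trans ?_
  calc ∑ i, ‖fderiv ℝ (fun z : Fin m → ℝ => chartExpression x₀ f (WithLp.toLp 2 z)) y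
        (Pi.single i 1)‖
      ≤ ∑ _i : Fin m, C * hsNorm (mvfderiv (𝓡 m) f
        ((chartAt 𝔼 x₀).symm (WithLp.toLp 2 y))) := by
        refine Finset.sum_le_sum fun i _ => ?_
        rw [hcomp]
        have := fderiv_chartExpression hf hy i
        refine (congrArg norm this).le.trans ?_
        refine (norm_apply_le_hsNorm _ _).trans ?_
        rw [mul_comm]
        exact mul_le_mul_of_nonneg_right (hC i) (hsNorm_nonneg _)
    _ = _ := by simp [mul_assoc]

/-- **Rellich's theorem** for functions on `M` with support in a small compact set. -/
lemma exists_nhds_rellich (x₀ : M) :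
    ∃ U ∈ 𝓝 x₀, ∀ K : Set M, IsCompact K → K ⊆ U → ∀ f : ℕ → M → ℝ,
      (∀ n, ContMDiff (𝓡 m) 𝓘(ℝ, ℝ) ∞ (f n)) → (∀ n, ∀ x ∉ K, f n x = 0) →
      ∀ B : ℝ≥0∞, B ≠ ⊤ → (∀ n, ∫⁻ x, ‖f n x‖ₑ ∂(riemannianVolume m M) ≤ B) →
      (∀ n, ∫⁻ x, ‖hsNorm (mvfderiv (𝓡 m) (f n) x)‖ₑ ∂(riemannianVolume m M) ≤ B) →
      ∃ φ : ℕ → ℕ, StrictMono φ ∧ ∀ᵐ x ∂(riemannianVolume m M),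
        ∃ l, Tendsto (fun n => f (φ n) x) atTop (𝓝 l) := by
  obtain ⟨c, hc, C, hev⟩ := exists_bounds_coordVector (m := m) x₀
  set e := chartAt 𝔼 x₀ with he
  obtain ⟨N, hN, hNo, hxN⟩ := eventually_nhds_iff.1 hev
  refine ⟨e.source ∩ e ⁻¹' N, (e.isOpen_inter_preimage hNo).mem_nhds
    ⟨mem_chart_source 𝔼 x₀, hxN⟩, fun K hK hKU f hf hfK B hB h0 h1 => ?_⟩
  have hKs : K ⊆ e.source := hKU.trans Set.inter_subset_left
  have hKN : e '' K ⊆ N := Set.image_subset_iff.2 (hKU.trans Set.inter_subset_right)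
  have hNt : N ⊆ e.target := fun y hy => (hN y hy).1
  let g (n : ℕ) (y : Fin m → ℝ) : ℝ := chartExpression x₀ (f n) (WithLp.toLp 2 y)
  have hgE (n) : ContDiff ℝ 1 (chartExpression (m := m) x₀ (f n)) :=
    contDiff_chartExpression (hf n) hK hKs (hfK n)
  have hg (n) : ContDiff ℝ 1 (g n) :=
    (hgE n).comp (PiLp.continuousLinearEquiv 2 ℝ fun _ : Fin m => ℝ).symm.contDiff
  have hmp := PiLp.volume_preserving_toLp (Fin m)
  have hemb : MeasurableEmbedding (WithLp.toLp 2 : (Fin m → ℝ) → 𝔼) :=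
    (MeasurableEquiv.toLp 2 (Fin m → ℝ)).measurableEmbedding
  -- On `N` the density is at least `c`, so Lebesgue integrals over `N` are controlled by integrals
  -- over `M`. Off `N` the chart expressions and their derivatives vanish because `K` is mapped into
  -- `N`.
  have hlint : ∀ h : M → ℝ≥0∞, Measurable h →
      ∫⁻ y : Fin m → ℝ, N.indicator (fun z => h (e.symm z)) (WithLp.toLp 2 y) ≤
        (ENNReal.ofReal c)⁻¹ * ∫⁻ x, h x ∂(riemannianVolume m M) := by
    intro h hh
    rw [hmp.lintegral_comp_emb hemb (N.indicator fun z => h (e.symm z)),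
      lintegral_indicator hNo.measurableSet]
    exact setLIntegral_comp_chart_symm_le x₀ hNo.measurableSet hNt hc (fun y hy => (hN y hy).2.1) hh
  have hcinv : (ENNReal.ofReal c)⁻¹ ≠ ⊤ := ENNReal.inv_ne_top.2 (ENNReal.ofReal_pos.2 hc).ne'
  have hg0 (n) : ∫⁻ y, ‖g n y‖ₑ ≤ (ENNReal.ofReal c)⁻¹ * B := by
    refine le_trans (lintegral_mono fun y => ?_) ((hlint (fun x => ‖f n x‖ₑ)
      (hf n).continuous.enorm.measurable).trans (mul_le_mul_right (h0 n) _))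
    by_cases hy : WithLp.toLp 2 y ∈ N
    · rw [Set.indicator_of_mem hy]
      simp only [g, chartExpression]
      rw [Set.indicator_of_mem (hNt hy)]
    · simp only [g]
      rw [chartExpression_eq_zero (hfK n) fun h => hy (hKN h)]
      simp
  have hg1 (n) : ∫⁻ y, ‖fderiv ℝ (g n) y‖ₑ ≤
      ENNReal.ofReal (m * C) * ((ENNReal.ofReal c)⁻¹ * B) := by
    have hmeas := (continuous_hsNorm_mvfderiv (hf n)).enorm.measurable
    have hmeas' := (hmeas.const_mul (ENNReal.ofReal (m * C)))
    refine le_trans (lintegral_mono fun y => ?_) ((hlint _ hmeas').trans ?_)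
    · by_cases hy : WithLp.toLp 2 y ∈ N
      · rw [Set.indicator_of_mem hy, ← ofReal_norm, ← ofReal_norm (hsNorm _),
          Real.norm_of_nonneg (hsNorm_nonneg _), ← ENNReal.ofReal_mul' (hsNorm_nonneg _)]
        exact ENNReal.ofReal_le_ofReal (norm_fderiv_chartExpression_comp_le (hf n) (hNt hy)
          ((hgE n).differentiable one_ne_zero _) (hN _ hy).2.2)
      · have hz : g n =ᶠ[𝓝 y] fun _ => 0 :=
          (chartExpression_eventuallyEq_zero hK hKs (hfK n) fun h => hy (hKN h)).comp_tendsto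
            (PiLp.continuous_toLp 2 fun _ : Fin m => ℝ).continuousAt
        have h0 : ‖fderiv ℝ (g n) y‖ₑ = 0 := by
          rw [← ofReal_norm, hz.fderiv_eq, fderiv_fun_const]
          simp
        rw [h0]
        exact zero_le
    · rw [lintegral_const_mul _ hmeas, mul_left_comm]
      gcongr
      exact h1 n
  set B' : ℝ≥0∞ := (ENNReal.ofReal c)⁻¹ * B + ENNReal.ofReal (m * C) * ((ENNReal.ofReal c)⁻¹ * B)
  have hB' : B' ≠ ⊤ := ENNReal.add_ne_top.2 ⟨ENNReal.mul_ne_top hcinv hB,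
    ENNReal.mul_ne_top ENNReal.ofReal_ne_top (ENNReal.mul_ne_top hcinv hB)⟩
  have hs : volume (WithLp.toLp 2 ⁻¹' (e '' K) : Set (Fin m → ℝ)) ≠ ⊤ := by
    rw [hmp.measure_preimage_emb hemb]
    exact (isCompact_chart_image hK hKs).measure_lt_top.ne
  obtain ⟨φ, hφ, hae⟩ := exists_subseq_ae_tendsto_of_contDiff hg hB'
    (fun n => (hg0 n).trans le_self_add) (fun n => (hg1 n).trans le_add_self) hs
  refine ⟨φ, hφ, ?_⟩
  rw [ae_restrict_iff'₀ (hemb.measurable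
    (isCompact_chart_image hK hKs).measurableSet).nullMeasurableSet] at hae
  have hbad : volume {z : 𝔼 | ¬ (z ∈ e '' K → ∃ l, Tendsto (fun n =>
      chartExpression x₀ (f (φ n)) z) atTop (𝓝 l))} = 0 := by
    rw [← hmp.measure_preimage_emb hemb]
    exact hae
  -- The exceptional set is replaced by a measurable hull, because the transfer of null sets to `M`
  -- asks for measurability.
  have hnull := riemannianVolume_preimage_chart_eq_zero x₀ (measurableSet_toMeasurable volume _)
    ((measure_toMeasurable _).trans hbad)
  filter_upwards [measure_eq_zero_iff_ae_notMem.1 hnull] with x hx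
  by_cases hxK : x ∈ K
  · have hxs := hKs hxK
    obtain ⟨l, hl⟩ : ∃ l, Tendsto (fun n => chartExpression x₀ (f (φ n)) (e x)) atTop (𝓝 l) := by
      by_contra hcon
      exact hx ⟨hxs, subset_toMeasurable volume _ fun himp => hcon (himp ⟨x, hxK, rfl⟩)⟩
    refine ⟨l, ?_⟩
    simpa only [he, chartExpression_apply _ hxs] using hl
  · exact ⟨0, by simp [hfK _ x hxK]⟩

end LocalRellich

/-! ### Diagonal subsequences -/

section Diagonal

/-- The diagonal argument for countably many properties of subsequences. -/
lemma exists_strictMono_forall {ι : Type*} [Countable ι] {P : ι → (ℕ → ℕ) → Prop}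
    (hex : ∀ i φ, StrictMono φ → ∃ ψ : ℕ → ℕ, StrictMono ψ ∧ P i (φ ∘ ψ))
    (hP : ∀ i φ ψ (κ : ℕ → ℕ), P i φ → Tendsto κ atTop atTop → ψ =ᶠ[atTop] φ ∘ κ → P i ψ) :
    ∃ φ : ℕ → ℕ, StrictMono φ ∧ ∀ i, P i φ := by
  rcases isEmpty_or_nonempty ι with hι | hι
  · exact ⟨id, strictMono_id, fun i => hι.elim i⟩
  obtain ⟨j, hj⟩ := exists_surjective_nat ι
  choose ψ hψ hψP using hex
  -- The nested subsequences: the step from `n` to `n + 1` refines so as to satisfy property `j n`.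
  let Φ (n : ℕ) : {φ : ℕ → ℕ // StrictMono φ} := Nat.rec ⟨id, strictMono_id⟩
    (fun n φ => ⟨φ.1 ∘ ψ (j n) φ.1 φ.2, φ.2.comp (hψ (j n) φ.1 φ.2)⟩) n
  have hΦ (n : ℕ) : (Φ (n + 1)).1 = (Φ n).1 ∘ ψ (j n) (Φ n).1 (Φ n).2 := rfl
  have hΦP (n : ℕ) : P (j n) (Φ (n + 1)).1 := hψP (j n) (Φ n).1 (Φ n).2
  have hfac (i k : ℕ) : ∃ κ : ℕ → ℕ, StrictMono κ ∧ (Φ (i + k)).1 = (Φ i).1 ∘ κ := by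
    induction k with
    | zero => exact ⟨id, strictMono_id, rfl⟩
    | succ k ih =>
      obtain ⟨κ, hκ, h⟩ := ih
      refine ⟨κ ∘ ψ (j (i + k)) (Φ (i + k)).1 (Φ (i + k)).2, hκ.comp (hψ _ _ _), ?_⟩
      funext n
      exact congrFun h _
  choose κ hκ hκΦ using hfac
  refine ⟨fun n => (Φ n).1 n, strictMono_nat_of_lt_succ fun n => ?_, fun i => ?_⟩
  · rw [hΦ]
    exact (Φ n).2 ((Nat.lt_succ_self n).trans_le ((hψ _ _ _).id_le (n + 1)))
  · obtain ⟨n, rfl⟩ := hj i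
    -- For `k ≥ n + 1` the `k`-th diagonal term is a term of the subsequence `Φ (n + 1)`, at a
    -- position that is at least `k`. The truncated subtraction for smaller `k` is harmless since
    -- agreement is only needed eventually.
    refine hP _ _ _ (fun k => κ (n + 1) (k - (n + 1)) k) (hΦP n)
      (tendsto_atTop_mono (fun k => (hκ _ _).id_le k) tendsto_id) ?_
    filter_upwards [eventually_ge_atTop (n + 1)] with k hk
    have := congrFun (hκΦ (n + 1) (k - (n + 1))) k
    rwa [Nat.add_sub_cancel' hk] at this

end Diagonal

/-! ### Convergence tested on a basis -/

section InnerConvergence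

/-- By linearity the inner products with every fixed vector converge, in particular the coefficients
in an orthonormal basis. The given basis need not be orthonormal, as bundle frames are not. -/
lemma exists_tendsto_of_tendsto_inner {W ι : Type*} [NormedAddCommGroup W]
    [InnerProductSpace ℝ W] [Fintype ι] (w : Module.Basis ι ℝ W) {u : ℕ → W}
    (h : ∀ i, ∃ l, Tendsto (fun n => inner ℝ (u n) (w i)) atTop (𝓝 l)) :
    ∃ l, Tendsto u atTop (𝓝 l) := by
  have : FiniteDimensional ℝ W := w.finiteDimensional_of_finite
  have hz (z : W) : ∃ l, Tendsto (fun n => inner ℝ z (u n)) atTop (𝓝 l) := by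
    choose l hl using h
    refine ⟨∑ i, w.repr z i * l i, ?_⟩
    refine (tendsto_finsetSum Finset.univ fun i _ => (hl i).const_mul (w.repr z i)).congr fun n => ?_
    conv_rhs => rw [← w.sum_repr z, sum_inner]
    simp [inner_smul_left, real_inner_comm]
  choose l hl using hz
  let b := stdOrthonormalBasis ℝ W
  refine ⟨∑ i, l (b i) • b i, ?_⟩
  refine (tendsto_finsetSum Finset.univ fun i _ => (hl (b i)).smul_const (b i)).congr fun n => ?_
  exact b.sum_repr' (u n)

end InnerConvergence

/-! ### Local almost everywhere convergence of sections -/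

section Patch

variable {𝕜 : Type*} [RCLike 𝕜] {m : ℕ}
  {M : Type*} [TopologicalSpace M] [SecondCountableTopology M]
  [ChartedSpace (EuclideanSpace ℝ (Fin m)) M] [IsManifold (𝓡 m) ∞ M]
  [RiemannianBundle (fun x : M => TangentSpace (𝓡 m) x)]
  [IsContMDiffRiemannianBundle (𝓡 m) ∞ (EuclideanSpace ℝ (Fin m))
    (fun x : M => TangentSpace (𝓡 m) x)]
  [MeasurableSpace M] [BorelSpace M]
  {F : Type*} [NormedAddCommGroup F] [NormedSpace ℝ F] [NormedSpace 𝕜 F] [IsScalarTower ℝ 𝕜 F]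
  [FiniteDimensional ℝ F]
  {V : M → Type*} [TopologicalSpace (TotalSpace F V)]
  [∀ x, NormedAddCommGroup (V x)] [∀ x, InnerProductSpace ℝ (V x)]
  [∀ x, InnerProductSpace 𝕜 (V x)] [∀ x, IsScalarTower ℝ 𝕜 (V x)]
  [FiberBundle F V] [VectorBundle ℝ F V] [VectorBundle 𝕜 F V]
  [ContMDiffVectorBundle ∞ F V (𝓡 m)] [IsContMDiffRiemannianBundle (𝓡 m) ∞ F V]

lemma TestSection.exists_norm_le {τ : ∀ x, V x} (hτ : TestSection m F τ) :
    ∃ C, ∀ x, ‖τ x‖ ≤ C := by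
  have := isContinuousRiemannianBundle_of_smooth (F := F) (V := V) m
  obtain ⟨hsm, K, hK, hτK⟩ := hτ
  have hc : Continuous fun x => ‖τ x‖ := (continuous_fiber_norm F V).comp hsm.continuous
  obtain ⟨C, hC⟩ := hK.exists_bound_of_continuousOn hc.continuousOn
  refine ⟨max C 0, fun x => ?_⟩
  by_cases hx : x ∈ K
  · exact (by simpa using hC x hx : ‖τ x‖ ≤ C).trans (le_max_left _ _)
  · simp [hτK x hx]

lemma MetricConnection.exists_hsNorm_le [T2Space M] (D : MetricConnection 𝕜 m F V)
    {τ : ∀ x, V x} (hτ : TestSection m F τ) :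
    ∃ C, ∀ x, hsNorm (D.toCovariantDerivative τ x) ≤ C := by
  obtain ⟨hsm, K, hK, hτK⟩ := hτ
  obtain ⟨C, hC⟩ := hK.exists_bound_of_continuousOn (D.continuous_hsNorm hsm).continuousOn
  refine ⟨max C 0, fun x => ?_⟩
  by_cases hx : x ∈ K
  · exact (le_abs_self _).trans ((hC x hx).trans (le_max_left _ _))
  -- Off the closed set `K` the section vanishes in a neighbourhood, so its covariant derivative is
  -- zero there by locality.
  · have h0 : D.toCovariantDerivative τ x = D.toCovariantDerivative (0 : ∀ x, V x) x := by
      refine D.toCovariantDerivative.isCovariantDerivativeOnUniv.congr_of_eventuallyEq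
        (hsm.mdifferentiableAt x) ((TestSection.zero (F := F)).1.mdifferentiableAt x)
        univ_mem ?_
      filter_upwards [hK.isClosed.isOpen_compl.mem_nhds hx] with y hy
      exact hτK y hy
    rw [h0, D.toCovariantDerivative.zero]
    simp [hsNorm_zero]

/-- The product rule and Cauchy-Schwarz. For a fixed test section `τ` this carries bounds on `σ` and
`∇σ` over to the scalar function `⟨σ, τ⟩`. -/
lemma MetricConnection.hsNorm_mvfderiv_inner_le (D : MetricConnection 𝕜 m F V) {σ τ : ∀ x, V x}
    (hσ : SmoothSection m F σ) (hτ : SmoothSection m F τ) (x : M) :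
    hsNorm (mvfderiv (𝓡 m) (fun y => inner ℝ (σ y) (τ y)) x) ≤
      ‖τ x‖ * hsNorm (D.toCovariantDerivative σ x) +
        ‖σ x‖ * hsNorm (D.toCovariantDerivative τ x) := by
  have hsplit : mvfderiv (𝓡 m) (fun y => inner ℝ (σ y) (τ y)) x =
      (innerSL ℝ (τ x)).comp (D.toCovariantDerivative σ x) +
        (innerSL ℝ (σ x)).comp (D.toCovariantDerivative τ x) := by
    ext ξ
    rw [D.mvfderiv_inner hσ hτ, real_inner_comm]
    rfl
  have hle (v : V x) (A : TangentSpace (𝓡 m) x →L[ℝ] V x) :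
      hsNorm ((innerSL ℝ v).comp A) ≤ ‖v‖ * hsNorm A := by
    rw [← norm_norm v, ← hsNorm_smul (𝕜 := ℝ) ‖v‖ A]
    refine hsNorm_le_of_forall fun ξ => ?_
    rw [smul_apply, norm_smul, norm_norm]
    exact norm_inner_le_norm _ _
  rw [hsplit]
  exact (hsNorm_add_le _ _).trans (add_le_add (hle _ _) (hle _ _))

/-- Near every point there is a family of test sections with support in a given neighbourhood
which is a frame of the bundle near that point. -/
lemma exists_testSection_frame [T2Space M] (x₀ : M) {U : Set M} (hU : U ∈ 𝓝 x₀) :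
    ∃ (d : ℕ) (τ : Fin d → ∀ x, V x) (K : Set M), IsCompact K ∧ K ⊆ U ∧
      (∀ a, SmoothSection m F (τ a) ∧ ∀ x ∉ K, τ a x = 0) ∧
      ∀ᶠ x in 𝓝 x₀, ∃ w : Module.Basis (Fin d) ℝ (V x), ∀ a, w a = τ a x := by
  let t := trivializationAt F V x₀
  let b := Module.finBasis ℝ F
  have ht : x₀ ∈ t.baseSet := FiberBundle.mem_baseSet_trivializationAt' x₀
  -- The cutoff is supported inside the trivializing set, so the cut-off frame extends smoothly by
  -- zero. It equals `1` near `x₀`, so there the frame is unchanged.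
  obtain ⟨χ, -, hχ⟩ := (SmoothBumpFunction.nhds_basis_tsupport (I := 𝓡 m) x₀).mem_iff.1
    (inter_mem hU (t.open_baseSet.mem_nhds ht))
  refine ⟨_, fun a => (χ : M → ℝ) • t.localFrame b a, tsupport χ, χ.hasCompactSupport,
    hχ.trans Set.inter_subset_left, fun a => ⟨fun x => ?_, fun x hx => ?_⟩, ?_⟩
  · by_cases hx : x ∈ tsupport χ
    · exact ContMDiffAt.smul_section χ.contMDiffAt
        (contMDiffAt_localFrame_of_mem ∞ t b a (hχ hx).2)
    · refine ((contMDiff_zeroSection ℝ V) x).congr_of_eventuallyEq ?_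
      filter_upwards [(isClosed_tsupport χ).isOpen_compl.mem_nhds hx] with y hy
      simp [image_eq_zero_of_notMem_tsupport hy, zeroSection]
  · simp [image_eq_zero_of_notMem_tsupport hx]
  · filter_upwards [χ.eventuallyEq_one, t.open_baseSet.mem_nhds ht] with x hx hxt
    refine ⟨t.basisAt b hxt, fun a => ?_⟩
    simp [hx, hxt]

/-- Near every point, sequences of sections which are bounded in `W^{1,2}` have subsequences that
converge almost everywhere. -/
lemma MetricConnection.exists_nhds_subseq_ae_tendsto [T2Space M] (D : MetricConnection 𝕜 m F V)
    (hfin : riemannianVolume m M Set.univ < ⊤) (x₀ : M) :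
    ∃ U ∈ 𝓝 x₀, ∀ u : ℕ → ∀ x, V x, (∀ n, SmoothSection m F (u n)) → ∀ B : ℝ≥0∞, B ≠ ⊤ →
      (∀ n, eLpNorm (fun x => ‖u n x‖) 2 (riemannianVolume m M) ≤ B) →
      (∀ n, eLpNorm (fun x => hsNorm (D.toCovariantDerivative (u n) x)) 2
        (riemannianVolume m M) ≤ B) →
      ∃ φ : ℕ → ℕ, StrictMono φ ∧ ∀ᵐ x ∂(riemannianVolume m M), x ∈ U →
        ∃ l, Tendsto (fun n => u (φ n) x) atTop (𝓝 l) := by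
  obtain ⟨U, hU, hrellich⟩ := exists_nhds_rellich (m := m) x₀
  obtain ⟨d, τ, K, hK, hKU, hτ, hframe⟩ := exists_testSection_frame (m := m) (F := F) (V := V) x₀ hU
  refine ⟨_, hframe, fun u hu B hB h0 h1 => ?_⟩
  set μ := riemannianVolume m M
  have hsub (a : Fin d) (φ : ℕ → ℕ) : ∃ ψ : ℕ → ℕ, StrictMono ψ ∧
      ∀ᵐ x ∂μ, ∃ l, Tendsto (fun n => inner ℝ (u ((φ ∘ ψ) n) x) (τ a x)) atTop (𝓝 l) := by
    have hτt : TestSection m F (τ a) := ⟨(hτ a).1, K, hK, (hτ a).2⟩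
    obtain ⟨C₁, hC₁⟩ := hτt.exists_norm_le (m := m)
    obtain ⟨C₂, hC₂⟩ := D.exists_hsNorm_le hτt
    -- Hölder's inequality on a space of finite volume turns the `L²`-bounds into `L¹`-bounds at the
    -- cost of the factor `vol(M) ^ (1 - 1/2)`.
    set B₁ : ℝ≥0∞ := B * μ Set.univ ^ (1 / (1 : ℝ≥0∞).toReal - 1 / (2 : ℝ≥0∞).toReal)
    have hB₁ : B₁ ≠ ⊤ := ENNReal.mul_ne_top hB
      (ENNReal.rpow_ne_top_of_nonneg (by norm_num) hfin.ne)
    have hu1 (n) : ∫⁻ x, ‖‖u n x‖‖ₑ ∂μ ≤ B₁ := by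
      rw [← eLpNorm_one_eq_lintegral_enorm]
      exact (eLpNorm_le_eLpNorm_mul_rpow_measure_univ one_le_two
        (aestronglyMeasurable_norm ((hu n).aemeasurableSection _))).trans
        (mul_le_mul_left (h0 n) _)
    have hdu1 (n) : ∫⁻ x, ‖hsNorm (D.toCovariantDerivative (u n) x)‖ₑ ∂μ ≤ B₁ := by
      rw [← eLpNorm_one_eq_lintegral_enorm]
      exact (eLpNorm_le_eLpNorm_mul_rpow_measure_univ one_le_two
        (aestronglyMeasurable_hsNorm (D.aemeasurableSection (hu n)))).trans
        (mul_le_mul_left (h1 n) _)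
    have hmeas (n) : Measurable fun x => ‖hsNorm (D.toCovariantDerivative (u n) x)‖ₑ :=
      (D.continuous_hsNorm (hu n)).enorm.measurable
    refine hrellich K hK hKU (fun n x => inner ℝ (u (φ n) x) (τ a x))
      (fun n => (hu _).inner (hτ a).1) (fun n x hx => by simp [(hτ a).2 x hx])
      (ENNReal.ofReal C₁ * B₁ + (ENNReal.ofReal C₁ * B₁ + ENNReal.ofReal C₂ * B₁))
      (by finiteness) (fun n => ?_) fun n => ?_
    · refine le_trans ?_ le_self_add
      calc ∫⁻ x, ‖inner ℝ (u (φ n) x) (τ a x)‖ₑ ∂μ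
          ≤ ∫⁻ x, ENNReal.ofReal C₁ * ‖‖u (φ n) x‖‖ₑ ∂μ := by
            refine lintegral_mono fun x => ?_
            rw [← ofReal_norm, ← ofReal_norm ‖_‖, norm_norm,
              ← ENNReal.ofReal_mul' (norm_nonneg _), mul_comm]
            exact ENNReal.ofReal_le_ofReal ((norm_inner_le_norm _ _).trans
              (mul_le_mul_of_nonneg_left (hC₁ x) (norm_nonneg _)))
        _ ≤ ENNReal.ofReal C₁ * B₁ := by
            rw [lintegral_const_mul' _ _ ENNReal.ofReal_ne_top]
            exact mul_le_mul_right (hu1 _) _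
    · refine le_trans ?_ le_add_self
      calc ∫⁻ x, ‖hsNorm (mvfderiv (𝓡 m) (fun x => inner ℝ (u (φ n) x) (τ a x)) x)‖ₑ ∂μ
          ≤ ∫⁻ x, (ENNReal.ofReal C₁ * ‖hsNorm (D.toCovariantDerivative (u (φ n)) x)‖ₑ +
              ENNReal.ofReal C₂ * ‖‖u (φ n) x‖‖ₑ) ∂μ := by
            refine lintegral_mono fun x => ?_
            have hC₁0 : 0 ≤ C₁ := (norm_nonneg _).trans (hC₁ x)
            have hC₂0 : 0 ≤ C₂ := (hsNorm_nonneg _).trans (hC₂ x)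
            rw [← ofReal_norm, ← ofReal_norm (hsNorm _), ← ofReal_norm ‖_‖, norm_norm,
              Real.norm_of_nonneg (hsNorm_nonneg _), Real.norm_of_nonneg (hsNorm_nonneg _),
              ← ENNReal.ofReal_mul hC₁0, ← ENNReal.ofReal_mul hC₂0,
              ← ENNReal.ofReal_add (mul_nonneg hC₁0 (hsNorm_nonneg _))
                (mul_nonneg hC₂0 (norm_nonneg _))]
            refine ENNReal.ofReal_le_ofReal
              ((D.hsNorm_mvfderiv_inner_le (hu (φ n)) (hτ a).1 x).trans ?_)
            rw [mul_comm C₂]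
            exact add_le_add (mul_le_mul_of_nonneg_right (hC₁ x) (hsNorm_nonneg _))
              (mul_le_mul_of_nonneg_left (hC₂ x) (norm_nonneg _))
        _ ≤ ENNReal.ofReal C₁ * B₁ + ENNReal.ofReal C₂ * B₁ := by
            rw [lintegral_add_left ((hmeas _).const_mul _),
              lintegral_const_mul' _ _ ENNReal.ofReal_ne_top,
              lintegral_const_mul' _ _ ENNReal.ofReal_ne_top]
            exact add_le_add (mul_le_mul_right (hdu1 _) _) (mul_le_mul_right (hu1 _) _)
  -- One subsequence for all members of the frame; the pairings with them determine the limit in the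
  -- fibre.
  obtain ⟨φ, hφ, hconv⟩ := exists_strictMono_forall (P := fun (a : Fin d) φ =>
      ∀ᵐ x ∂μ, ∃ l, Tendsto (fun n => inner ℝ (u (φ n) x) (τ a x)) atTop (𝓝 l))
    (fun a φ _ => hsub a φ) (by
      intro a φ ψ κ hφ hκ hψ
      filter_upwards [hφ] with x ⟨l, hl⟩
      refine ⟨l, (hl.comp hκ).congr' ?_⟩
      filter_upwards [hψ] with n hn
      simp only [Function.comp_apply, hn])
  refine ⟨φ, hφ, ?_⟩
  filter_upwards [ae_all_iff.2 hconv] with x hx hxU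
  obtain ⟨w, hw⟩ := hxU
  exact exists_tendsto_of_tendsto_inner w fun a => by simpa only [hw a] using hx a

end Patch

/-! ### From almost everywhere convergence to `L^p` -/

section VitaliConvergence

/-- Almost everywhere convergence to zero together with a bound in `L^q` implies convergence in
`L^p` for `p < q`, on a finite measure space. -/
lemma tendsto_eLpNorm_of_tendsto_ae_of_eLpNorm_le {α : Type*} [MeasurableSpace α] {μ : Measure α}
    [IsFiniteMeasure μ] {p q : ℝ≥0∞} (hp : 1 ≤ p) (hpq : p < q) (hq : q ≠ ⊤) {f : ℕ → α → ℝ}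
    (hf : ∀ n, AEStronglyMeasurable (f n) μ) {B : ℝ≥0∞} (hB : B ≠ ⊤)
    (hfB : ∀ n, eLpNorm (f n) q μ ≤ B)
    (hlim : ∀ᵐ x ∂μ, Tendsto (fun n => f n x) atTop (𝓝 0)) :
    Tendsto (fun n => eLpNorm (f n) p μ) atTop (𝓝 0) := by
  have hp0 : 0 < p.toReal := ENNReal.toReal_pos (by positivity) (hpq.trans_le le_top).ne
  have hpq' : p.toReal < q.toReal := (ENNReal.toReal_lt_toReal (hpq.trans_le le_top).ne hq).2 hpq
  set θ : ℝ := 1 / p.toReal - 1 / q.toReal with hθ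
  have hθ0 : 0 < θ := sub_pos.2 (one_div_lt_one_div_of_lt hp0 hpq')
  -- Hölder's inequality bounds the `L^p`-norm over a set `s` by `B * μ(s) ^ θ`. The exponent `θ` is
  -- positive because `p < q`, so the bound is small on small sets.
  have hui : UnifIntegrable f p μ := by
    intro ε hε
    have h0 : Tendsto (fun δ : ℝ => B * ENNReal.ofReal δ ^ θ) (𝓝 0) (𝓝 0) := by
      have h1 : Tendsto (fun δ : ℝ => ENNReal.ofReal δ ^ θ) (𝓝 0) (𝓝 0) := by
        have := (ENNReal.continuous_rpow_const (y := θ)).comp ENNReal.continuous_ofReal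
        simpa [Function.comp_def, ENNReal.zero_rpow_of_pos hθ0] using this.tendsto 0
      simpa using ENNReal.Tendsto.const_mul h1 (Or.inr hB)
    obtain ⟨δ, hδ, hδ0⟩ := ((h0.mono_left nhdsWithin_le_nhds).eventually_lt_const
      (ENNReal.ofReal_pos.2 hε) |>.and (self_mem_nhdsWithin (s := Set.Ioi (0 : ℝ)))).exists
    refine ⟨δ, hδ0, fun n s hs hμs => ?_⟩
    rw [eLpNorm_indicator_eq_eLpNorm_restrict hs]
    calc eLpNorm (f n) p (μ.restrict s)
        ≤ eLpNorm (f n) q (μ.restrict s) * (μ.restrict s) Set.univ ^ θ :=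
          eLpNorm_le_eLpNorm_mul_rpow_measure_univ hpq.le (hf n).restrict
      _ ≤ B * ENNReal.ofReal δ ^ θ := by
          rw [Measure.restrict_apply_univ]
          exact mul_le_mul' ((eLpNorm_mono_measure _ Measure.restrict_le_self).trans (hfB n))
            (ENNReal.rpow_le_rpow hμs hθ0.le)
      _ ≤ ENNReal.ofReal ε := hδ.le
  simpa [Pi.sub_def] using tendsto_Lp_finite_of_tendsto_ae (g := fun _ => (0 : ℝ)) hp
    (hpq.trans_le le_top).ne hf MemLp.zero' hui hlim

end VitaliConvergence

/-! ### Compactness of the inclusion into `L²` -/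

section Compactness

variable {𝕜 : Type*} [RCLike 𝕜] {m : ℕ}
  {M : Type*} [TopologicalSpace M] [SecondCountableTopology M]
  [ChartedSpace (EuclideanSpace ℝ (Fin m)) M] [IsManifold (𝓡 m) ∞ M]
  [RiemannianBundle (fun x : M => TangentSpace (𝓡 m) x)]
  [IsContMDiffRiemannianBundle (𝓡 m) ∞ (EuclideanSpace ℝ (Fin m))
    (fun x : M => TangentSpace (𝓡 m) x)]
  [MeasurableSpace M] [BorelSpace M]
  {F : Type*} [NormedAddCommGroup F] [NormedSpace ℝ F] [NormedSpace 𝕜 F] [IsScalarTower ℝ 𝕜 F]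
  [FiniteDimensional ℝ F]
  {V : M → Type*} [TopologicalSpace (TotalSpace F V)]
  [∀ x, NormedAddCommGroup (V x)] [∀ x, InnerProductSpace ℝ (V x)]
  [∀ x, InnerProductSpace 𝕜 (V x)] [∀ x, IsScalarTower ℝ 𝕜 (V x)]
  [FiberBundle F V] [VectorBundle ℝ F V] [VectorBundle 𝕜 F V]
  [ContMDiffVectorBundle ∞ F V (𝓡 m)] [IsContMDiffRiemannianBundle (𝓡 m) ∞ F V]

/-- Trivializations are continuous on each fibre, so the local expressions converge almost
everywhere. -/
lemma aemeasurableSection_of_tendsto_ae {μ : Measure M} {u : ℕ → ∀ x, V x} {s : ∀ x, V x}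
    (hu : ∀ n, AEMeasurableSection F μ (u n))
    (hlim : ∀ᵐ x ∂μ, Tendsto (fun n => u n x) atTop (𝓝 (s x))) :
    AEMeasurableSection F μ s := by
  intro e he
  refine aestronglyMeasurable_of_tendsto_ae atTop (fun n => hu n e he) ?_
  filter_upwards [ae_restrict_mem e.open_baseSet.measurableSet, ae_restrict_of_ae hlim] with x hx h
  have := ((e.continuousLinearMapAt ℝ x).continuous.tendsto (s x)).comp h
  simpa only [Function.comp_def, Trivialization.continuousLinearMapAt_apply,
    e.coe_linearMapAt_of_mem hx] using this

/-- On a manifold of finite volume, sequences of sections which are bounded in `W^{1,2}` have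
subsequences that converge almost everywhere. -/
lemma MetricConnection.exists_subseq_ae_tendsto [T2Space M] (D : MetricConnection 𝕜 m F V)
    (hfin : riemannianVolume m M Set.univ < ⊤) {u : ℕ → ∀ x, V x}
    (hu : ∀ n, SmoothSection m F (u n)) {B : ℝ≥0∞} (hB : B ≠ ⊤)
    (h0 : ∀ n, eLpNorm (fun x => ‖u n x‖) 2 (riemannianVolume m M) ≤ B)
    (h1 : ∀ n, eLpNorm (fun x => hsNorm (D.toCovariantDerivative (u n) x)) 2
      (riemannianVolume m M) ≤ B) :
    ∃ φ : ℕ → ℕ, StrictMono φ ∧ ∃ s : ∀ x, V x, ∀ᵐ x ∂(riemannianVolume m M),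
      Tendsto (fun n => u (φ n) x) atTop (𝓝 (s x)) := by
  choose U hU hconv using D.exists_nhds_subseq_ae_tendsto hfin
  -- By second countability countably many of the good neighbourhoods cover `M`, so the diagonal
  -- argument applies.
  obtain ⟨t, ht, htu⟩ := TopologicalSpace.countable_cover_nhds hU
  have := ht.to_subtype
  obtain ⟨φ, hφ, hφconv⟩ := exists_strictMono_forall (P := fun (y : t) φ =>
      ∀ᵐ x ∂(riemannianVolume m M), x ∈ U y → ∃ l, Tendsto (fun n => u (φ n) x) atTop (𝓝 l))
    (fun y φ _ => hconv y (fun n => u (φ n)) (fun n => hu _) B hB (fun n => h0 _) fun n => h1 _)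
    (by
      intro y φ ψ κ hφ hκ hψ
      filter_upwards [hφ] with x hx hxU
      obtain ⟨l, hl⟩ := hx hxU
      refine ⟨l, (hl.comp hκ).congr' ?_⟩
      filter_upwards [hψ] with n hn
      simp only [Function.comp_apply, hn])
  have hae : ∀ᵐ x ∂(riemannianVolume m M), ∃ l, Tendsto (fun n => u (φ n) x) atTop (𝓝 l) := by
    filter_upwards [ae_all_iff.2 hφconv] with x hx
    obtain ⟨y, hy, hxy⟩ := Set.mem_iUnion₂.1 (htu.ge (Set.mem_univ x))
    exact hx ⟨y, hy⟩ hxy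
  classical
  refine ⟨φ, hφ, fun x => if h : ∃ l, Tendsto (fun n => u (φ n) x) atTop (𝓝 l) then h.choose else 0,
    ?_⟩
  filter_upwards [hae] with x hx
  rw [dif_pos hx]
  exact hx.choose_spec

/-- On a manifold of finite volume with a Sobolev embedding, sequences of test sections which are
bounded in `W^{1,2}` have subsequences that converge in `L²`. -/
lemma MetricConnection.exists_subseq_tendsto_eLpNorm [T2Space M] (D : MetricConnection 𝕜 m F V)
    {q : ℝ≥0∞} {hq : 1 ≤ q} (h : SobolevEmbedding (trivialConnection m M) q hq) (hq2 : 2 < q)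
    (hqtop : q ≠ ⊤) (hfin : riemannianVolume m M Set.univ < ⊤) {u : ℕ → ∀ x, V x}
    (hu : ∀ n, TestSection m F (u n)) {B : ℝ≥0∞} (hB : B ≠ ⊤)
    (h0 : ∀ n, eLpNorm (fun x => ‖u n x‖) 2 (riemannianVolume m M) ≤ B)
    (h1 : ∀ n, eLpNorm (fun x => hsNorm (D.toCovariantDerivative (u n) x)) 2
      (riemannianVolume m M) ≤ B) :
    ∃ φ : ℕ → ℕ, StrictMono φ ∧ ∃ s : LpSection 𝕜 m F V 2,
      Tendsto (fun n => eLpNorm (fun x => ‖u (φ n) x - s.toSection x‖) 2 (riemannianVolume m M))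
        atTop (𝓝 0) := by
  obtain ⟨φ, hφ, s, hs⟩ := D.exists_subseq_ae_tendsto hfin (fun n => (hu n).1) hB h0 h1
  obtain ⟨C, hC, H⟩ := exists_eLpNorm_testSection_le (𝕜 := 𝕜) (F := F) (V := V) h
  have : IsFiniteMeasure (riemannianVolume m M) := ⟨hfin⟩
  have hum (n) := (hu n).1.aemeasurableSection (riemannianVolume m M)
  have hsm : AEMeasurableSection F (riemannianVolume m M) s :=
    aemeasurableSection_of_tendsto_ae (fun n => hum (φ n)) hs
  -- Fatou's lemma, used with exponent `2` to place the limit in `L²` and with exponent `q` for the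
  -- Vitali argument.
  have hbound (p B' : ℝ≥0∞)
      (hb : ∀ n, eLpNorm (fun x => ‖u n x‖) p (riemannianVolume m M) ≤ B') :
      eLpNorm (fun x => ‖s x‖) p (riemannianVolume m M) ≤ B' := by
    refine (Lp.eLpNorm_lim_le_liminf_eLpNorm (fun n => aestronglyMeasurable_norm (hum (φ n))) _
      (hs.mono fun x hx => hx.norm)).trans ?_
    refine (liminf_le_liminf (v := fun _ => B') (Eventually.of_forall fun n => hb (φ n))).trans ?_
    rw [liminf_const]
  have hq (n) : eLpNorm (fun x => ‖u n x‖) q (riemannianVolume m M) ≤ C * (B + B) :=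
    (H D (u n) (hu n) ((h0 n).trans_lt hB.lt_top) ((h1 n).trans_lt hB.lt_top)).trans
      (mul_le_mul_right (add_le_add (h0 n) (h1 n)) C)
  refine ⟨φ, hφ, ⟨s, hsm, (hbound 2 B h0).trans_lt hB.lt_top⟩, ?_⟩
  refine tendsto_eLpNorm_of_tendsto_ae_of_eLpNorm_le one_le_two hq2 hqtop
    (fun n => aestronglyMeasurable_norm ((hum (φ n)).sub ℝ hsm))
    (B := C * (B + B) + C * (B + B)) (by finiteness) (fun n => ?_)
    (hs.mono fun x hx => tendsto_iff_norm_sub_tendsto_zero.1 hx)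
  refine (eLpNorm_mono_real (g := fun x => ‖u (φ n) x‖ + ‖s x‖) fun x => ?_).trans
    ((eLpNorm_add_le (aestronglyMeasurable_norm (hum (φ n))) (aestronglyMeasurable_norm hsm)
      (one_le_two.trans hq2.le)).trans (add_le_add (hq _) (hbound q _ hq)))
  rw [norm_norm]
  exact norm_sub_le _ _

lemma LpSection.ofReal_norm_sub {p : ℝ≥0∞} [Fact (1 ≤ p)] (s t : LpSection 𝕜 m F V p) :
    ENNReal.ofReal ‖s - t‖ =
      eLpNorm (fun x => ‖s.toSection x - t.toSection x‖) p (riemannianVolume m M) := by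
  rw [LpSection.norm_def, ENNReal.ofReal_toReal (s - t).eLpNorm_lt_top.ne]
  rfl

/-- Elements of the unit ball of `W^{1,2}_0` are `L²`-limits of test sections bounded in
`W^{1,2}`. -/
lemma W0.exists_testSection_near {D : MetricConnection 𝕜 m F V} {s : W0 D} (hs : ‖s‖ < 1) {ε : ℝ≥0∞}
    (hε : 0 < ε) :
    ∃ u : ∀ x, V x, TestSection m F u ∧
      eLpNorm (fun x => ‖u x - (W0.toL2 D s).toSection x‖) 2 (riemannianVolume m M) < ε ∧
      eLpNorm (fun x => hsNorm (D.toCovariantDerivative u x)) 2 (riemannianVolume m M) ≤ 2 := by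
  rw [W0.norm_def] at hs
  obtain ⟨w₀, hw₀⟩ := s.2
  have hlt : minimalDerivativeNorm D (W0.toL2 D s) < 1 :=
    lt_of_le_of_lt (le_add_of_nonneg_left (norm_nonneg _)) hs
  -- Since the infimum is below `1`, some minimal derivative has norm below `1`. The final bound `2`
  -- adds an approximation error of at most `1`.
  obtain ⟨_, ⟨w, hw, rfl⟩, hw1⟩ := exists_lt_of_csInf_lt (by exact ⟨_, w₀, hw₀, rfl⟩) hlt
  obtain ⟨u, hu, hus, huw⟩ := hw.exists_approx
  obtain ⟨n, h1, h2⟩ := ((hus.eventually_lt_const hε).and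
    (huw.eventually_lt_const (zero_lt_one (α := ℝ≥0∞)))).exists
  refine ⟨u n, hu n, h1, ?_⟩
  refine (eLpNorm_hsNorm_le_sub_add (D.aemeasurableSection (hu n).1) hw.measurable).trans ?_
  refine (add_le_add h2.le ?_).trans one_add_one_eq_two.le
  rw [← ENNReal.ofReal_toReal hw.finite.ne, ← ENNReal.ofReal_one]
  exact ENNReal.ofReal_le_ofReal hw1.le

/-- The closure of the image of the unit ball is sequentially compact: its points are approximated
by elements of the image and these by test sections, with errors `1 / (n + 1)` that tend to zero. An
`L²`-convergent subsequence of the test sections therefore carries the original sequence along. -/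
theorem isCompactOperator_toL2 [T2Space M] (D : MetricConnection 𝕜 m F V)
    {q : ℝ≥0∞} {hq : 1 ≤ q} (h : SobolevEmbedding (trivialConnection m M) q hq) (hq2 : 2 < q)
    (hqtop : q ≠ ⊤) (hfin : riemannianVolume m M Set.univ < ⊤) :
    IsCompactOperator (W0.toL2 D) := by
  set A : Set (LpSection 𝕜 m F V 2) := W0.toL2 D '' Metric.ball 0 1
  refine ⟨closure A, IsSeqCompact.isCompact fun t ht => ?_,
    mem_of_superset (Metric.ball_mem_nhds 0 one_pos)
      fun s hs => subset_closure (Set.mem_image_of_mem _ hs)⟩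
  have hε (n : ℕ) : 0 < 1 / ((n : ℝ) + 1) := Nat.one_div_pos_of_nat
  have hex (n : ℕ) : ∃ s : W0 D, ‖s‖ < 1 ∧ ‖t n - W0.toL2 D s‖ < 1 / ((n : ℝ) + 1) := by
    obtain ⟨_, ⟨s, hs, rfl⟩, hts⟩ := Metric.mem_closure_iff.1 (ht n) _ (hε n)
    exact ⟨s, by simpa using hs, by rwa [← dist_eq_norm]⟩
  choose s hs hts using hex
  choose u hu hus hDu using fun n =>
    W0.exists_testSection_near (hs n) (ENNReal.ofReal_pos.2 (hε n))
  have hum (n) := (hu n).1.aemeasurableSection (riemannianVolume m M)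
  have hε1 (n : ℕ) : ENNReal.ofReal (1 / ((n : ℝ) + 1)) ≤ 1 := by
    rw [← ENNReal.ofReal_one]
    refine ENNReal.ofReal_le_ofReal (div_le_one_of_le₀ ?_ ?_) <;> linarith [n.cast_nonneg (α := ℝ)]
  have hu2 (n) : eLpNorm (fun x => ‖u n x‖) 2 (riemannianVolume m M) ≤ 2 := by
    refine (eLpNorm_norm_le_sub_add (t := (W0.toL2 D (s n)).toSection) one_le_two (hum n)
      (W0.toL2 D (s n)).2.1).trans ?_
    refine (add_le_add ((hus n).le.trans (hε1 n)) ?_).trans one_add_one_eq_two.le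
    have h1 : ‖W0.toL2 D (s n)‖ ≤ 1 :=
      (le_add_of_nonneg_right (minimalDerivativeNorm_nonneg D _)).trans (hs n).le
    have h2 := ENNReal.ofReal_le_ofReal h1
    rwa [LpSection.norm_def, ENNReal.ofReal_toReal (W0.toL2 D (s n)).eLpNorm_lt_top.ne,
      ENNReal.ofReal_one] at h2
  obtain ⟨φ, hφ, z, hz⟩ :=
    D.exists_subseq_tendsto_eLpNorm h hq2 hqtop hfin hu ENNReal.ofNat_ne_top hu2 hDu
  have hlim : Tendsto (t ∘ φ) atTop (𝓝 z) := by
    rw [tendsto_iff_norm_sub_tendsto_zero]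
    have hε0 : Tendsto (fun n : ℕ => 1 / ((φ n : ℝ) + 1)) atTop (𝓝 0) :=
      (tendsto_one_div_add_atTop_nhds_zero_nat (𝕜 := ℝ)).comp hφ.tendsto_atTop
    have hsum : Tendsto (fun n => 1 / ((φ n : ℝ) + 1) + (1 / ((φ n : ℝ) + 1) +
        (eLpNorm (fun x => ‖u (φ n) x - z.toSection x‖) 2 (riemannianVolume m M)).toReal))
        atTop (𝓝 0) := by
      have := (ENNReal.tendsto_toReal ENNReal.zero_ne_top).comp hz
      simpa using hε0.add (hε0.add this)
    refine squeeze_zero (fun n => norm_nonneg _) (fun n => ?_) hsum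
    let y : LpSection 𝕜 m F V 2 :=
      ⟨u (φ n), hum _, (hu2 _).trans_lt ENNReal.ofNat_lt_top⟩
    have h1 : ‖W0.toL2 D (s (φ n)) - y‖ ≤ 1 / ((φ n : ℝ) + 1) := by
      rw [norm_sub_rev, ← ENNReal.ofReal_le_ofReal_iff (hε _).le, LpSection.ofReal_norm_sub]
      exact (hus _).le
    have h2 : ‖y - z‖ =
        (eLpNorm (fun x => ‖u (φ n) x - z.toSection x‖) 2 (riemannianVolume m M)).toReal := rfl
    rw [← h2]
    calc ‖t (φ n) - z‖ = ‖(t (φ n) - W0.toL2 D (s (φ n))) +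
          ((W0.toL2 D (s (φ n)) - y) + (y - z))‖ := by congr 1; abel
      _ ≤ _ := (norm_add_le _ _).trans (add_le_add (hts _).le
          ((norm_add_le _ _).trans (add_le_add_left h1 _)))
  exact ⟨z, isClosed_closure.mem_of_tendsto hlim (Eventually.of_forall fun n => ht _), φ, hφ, hlim⟩

end Compactness

/-- The strict gap above `2` makes the Hölder exponent in the Vitali argument positive. -/
lemma two_lt_sobolevExponent {v : ℝ} (hv : 2 < v) : 2 < sobolevExponent v := by
  rw [sobolevExponent, ← ENNReal.ofReal_ofNat, ENNReal.ofReal_lt_ofReal_iff_of_nonneg (by norm_num),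
    lt_div_iff₀ (by linarith)]
  linarith

end SobolevBundle

end

theorem mainTheorem10
    (m : ℕ) (M : Type*) [TopologicalSpace M] [T2Space M] [SecondCountableTopology M]
    [ChartedSpace (EuclideanSpace ℝ (Fin m)) M] [IsManifold (𝓡 m) ∞ M]
    [RiemannianBundle (fun x : M => TangentSpace (𝓡 m) x)]
    [IsContMDiffRiemannianBundle (𝓡 m) ∞ (EuclideanSpace ℝ (Fin m))
      (fun x : M => TangentSpace (𝓡 m) x)]
    [MeasurableSpace M] [BorelSpace M]
    (v : ℝ) (hv : 2 < v)
    (hscalar : SobolevEmbedding (trivialConnection m M) (sobolevExponent v)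
      (one_le_sobolevExponent hv))
    (𝕜 : Type*) [RCLike 𝕜]
    (F : Type*) [NormedAddCommGroup F] [NormedSpace ℝ F] [NormedSpace 𝕜 F] [IsScalarTower ℝ 𝕜 F]
    [FiniteDimensional ℝ F]
    (V : M → Type*) [TopologicalSpace (TotalSpace F V)]
    [∀ x, NormedAddCommGroup (V x)] [∀ x, InnerProductSpace ℝ (V x)]
    [∀ x, InnerProductSpace 𝕜 (V x)] [∀ x, IsScalarTower ℝ 𝕜 (V x)]
    [FiberBundle F V] [VectorBundle ℝ F V] [VectorBundle 𝕜 F V]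
    [ContMDiffVectorBundle ∞ F V (𝓡 m)] [IsContMDiffRiemannianBundle (𝓡 m) ∞ F V]
    (D : MetricConnection 𝕜 m F V) :
    SobolevEmbedding D (sobolevExponent v) (one_le_sobolevExponent hv) ∧
      (riemannianVolume m M Set.univ < ⊤ → IsCompactOperator (W0.toL2 D)) :=
  ⟨sobolevEmbedding_of_trivialConnection hscalar D,
    isCompactOperator_toL2 D hscalar (two_lt_sobolevExponent hv) ENNReal.ofReal_ne_top⟩
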